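/- Let $\Omega=\{p=(x,y,z)\in\mathbb{R}^3: |p|=1,\ z\ge 0\}$ be the closed upper unit hemisphere, with boundary $\partial\Omega$ the equator, and let $R_\varphi$ be the rotation by the angle $\varphi$ about the $z$-axis. For real $\sigma\ge 0$, $\lambda\in\mathbb{R}$ and an integer $m\ge 0$ let $V_{\sigma,m}(\lambda)$ be the complex vector space of functions $F:\Omega\to\mathbb{C}$, twice continuously differentiable up to the boundary, with $$\Delta F+\lambda F=0 \ \text{ in the interior of } \Omega,\qquad \frac{\partial F}{\partial n}+\sigma F=0\ \text{ on }\partial\Omega,\qquad F(R_\varphi p)=e^{im\varphi}F(p)\ \ (\varphi\in\mathbb{R},\ p\in\Omega),$$ where $\Delta$ is the Laplace–Beltrami operator and $n$ is the outward normal. Let $\lambda_0(\sigma)\le\lambda_1(\sigma)\le\dots$ be the ordered desymmetrized Robin eigenvalues, in which each $\lambda$ is repeated $\sum_{m\ge 0}\dim V_{\sigma,m}(\lambda)$ times ($\sigma=0$ is the Neumann case), and let $d_n(\sigma)=\lambda_n(\sigma)-\lambda_n(0)$ be the Robin–Neumann gaps. For integers $m\ge 0$ put $$S_m(\nu)=2\tan\Big(\frac{\pi(m+\nu)}{2}\Big)\frac{\Gamma\left(\frac{\nu+m}{2}+1\right)\Gamma\left(\frac{\nu-m}{2}+1\right)}{\Gamma\left(\frac{\nu+m+1}{2}\right)\Gamma\left(\frac{\nu-m+1}{2}\right)},$$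 and for $\sigma>0$ and integers $\ell\ge 0$ let $\mathcal{E}_\ell(\sigma)$ be the set of all $\nu(\nu+1)$ such that $\ell<\nu<\ell+1$ and $S_m(\nu)=\sigma$ for some integer $m$ with $0\le m\le\ell$, $m\equiv\ell \bmod 2$. Fix $\sigma>0$. Then, as $\ell\to\infty$, $$\frac{1}{\#\mathcal{E}_\ell(\sigma)}\sum_{n:\ \lambda_n(\sigma)\in\mathcal{E}_\ell(\sigma)} d_n(\sigma)=2\sigma+O\big(\ell^{-1/2}\big),$$ where the implied constant may depend on $\sigma$. Moreover $$2\sigma=2\sigma\cdot\frac{\operatorname{length}(\partial\Omega)}{\operatorname{area}(\Omega)},$$ so the mean gap $2\sigma\cdot\operatorname{length}(\partial\Omega)/\operatorname{area}(\Omega)$ holds in each cluster asymptotically. -/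

import Mathlib

open scoped Laplacian

namespace RobinHemisphere

noncomputable section

/-- Euclidean three-space, with coordinates `p 0`, `p 1`, `p 2`. -/
abbrev E3 : Type := EuclideanSpace ℝ (Fin 3)

/-- The closed upper unit hemisphere `Ω`. -/
abbrev Hemisphere : Type := {p : E3 // ‖p‖ = 1 ∧ 0 ≤ p 2}

/-- The vector pointing to the north pole. -/
def north : E3 := EuclideanSpace.single 2 1

/-- The rotation `R_φ` of the hemisphere around the north-south axis. -/
def rotate (φ : ℝ) (p : Hemisphere) : Hemisphere :=
  ⟨!₂[Real.cos φ * p.1 0 - Real.sin φ * p.1 1, Real.sin φ * p.1 0 + Real.cos φ * p.1 1, p.1 2], by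
    have h := p.2.1
    rw [EuclideanSpace.norm_eq, Real.sqrt_eq_one] at h ⊢
    simp only [Fin.sum_univ_three, Real.norm_eq_abs, sq_abs] at h ⊢
    simp
    linear_combination h + ((p.1 0) ^ 2 + (p.1 1) ^ 2) * Real.sin_sq_add_cos_sq φ, by
    simpa using p.2.2⟩

/-- The extension of `F` that is constant on rays: `p ↦ F (p / ‖p‖)` on the closed upper half-space
without the origin (and `0` elsewhere). -/
def radialExt (F : Hemisphere → ℂ) (p : E3) : ℂ :=
  Function.extend (Subtype.val : Hemisphere → E3) F 0 (‖p‖⁻¹ • p)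

/-- The closed upper half-space without the origin. -/
def puncturedHalfSpace : Set E3 := {p | 0 ≤ p 2 ∧ p ≠ 0}

/-- `F` is twice continuously differentiable on the closed hemisphere, up to the boundary. -/
def IsC2 (F : Hemisphere → ℂ) : Prop := ContDiffOn ℝ 2 (radialExt F) puncturedHalfSpace

/-- The Laplace-Beltrami operator of the round sphere, at points of the open hemisphere: the
Euclidean Laplacian of the extension that is constant on rays. -/
def sphericalLaplacian (F : Hemisphere → ℂ) (p : Hemisphere) : ℂ := Δ (radialExt F) p.1

/-- At a point `p` of the equator, `F` has derivative `v` in the direction of the outward normal.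
The curve `t ↦ cos t • p + sin t • north` is the unit speed geodesic that enters the hemisphere
at `p` orthogonally to the equator, so `F` has derivative `-v` along it. -/
def HasOutwardNormalDeriv (F : Hemisphere → ℂ) (v : ℂ) (p : Hemisphere) : Prop :=
  HasDerivWithinAt (fun t : ℝ => radialExt F (Real.cos t • p.1 + Real.sin t • north)) (-v)
    (Set.Ici 0) 0

/-- `F` solves the Robin problem `Δ F + lam F = 0` in the open hemisphere, `∂F/∂n + σ F = 0` on the
equator (the Neumann problem for `σ = 0`). -/
structure SolvesRobin (σ lam : ℝ) (F : Hemisphere → ℂ) : Prop where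
  isC2 : IsC2 F
  eqn : ∀ p : Hemisphere, 0 < p.1 2 → sphericalLaplacian F p + (lam : ℂ) * F p = 0
  bdry : ∀ p : Hemisphere, p.1 2 = 0 →
    ∃ v : ℂ, HasOutwardNormalDeriv F v p ∧ v + (σ : ℂ) * F p = 0

/-- `F` belongs to the `m`-th sector: `F (R_φ p) = exp (i m φ) F p`. -/
def InSector (m : ℕ) (F : Hemisphere → ℂ) : Prop :=
  ∀ (φ : ℝ) (p : Hemisphere),
    F (rotate φ p) = Complex.exp (Complex.I * (m : ℂ) * (φ : ℂ)) * F p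

theorem radialExt_zero : radialExt 0 = 0 := by
  funext p
  unfold radialExt
  by_cases h : ∃ a : Hemisphere, a.1 = ‖p‖⁻¹ • p
  · obtain ⟨a, ha⟩ := h
    rw [← ha, Subtype.val_injective.extend_apply]
    rfl
  · rw [Function.extend_apply' _ _ _ h]
    rfl

theorem radialExt_add (F G : Hemisphere → ℂ) :
    radialExt (F + G) = radialExt F + radialExt G := by
  funext p
  simp only [Pi.add_apply]
  unfold radialExt
  by_cases h : ∃ a : Hemisphere, a.1 = ‖p‖⁻¹ • p
  · obtain ⟨a, ha⟩ := h
    rw [← ha]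
    simp only [Subtype.val_injective.extend_apply, Pi.add_apply]
  · simp only [Function.extend_apply' _ _ _ h, Pi.zero_apply, add_zero]

theorem radialExt_smul (c : ℂ) (F : Hemisphere → ℂ) :
    radialExt (c • F) = c • radialExt F := by
  funext p
  simp only [Pi.smul_apply]
  unfold radialExt
  by_cases h : ∃ a : Hemisphere, a.1 = ‖p‖⁻¹ • p
  · obtain ⟨a, ha⟩ := h
    rw [← ha]
    simp only [Subtype.val_injective.extend_apply, Pi.smul_apply]
  · simp only [Function.extend_apply' _ _ _ h, Pi.zero_apply, smul_zero]

theorem IsC2.contDiffAt {F : Hemisphere → ℂ} (hF : IsC2 F) (p : Hemisphere) (hp : 0 < p.1 2) :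
    ContDiffAt ℝ 2 (radialExt F) p.1 := by
  have ho : IsOpen {q : E3 | 0 < q 2} := isOpen_lt continuous_const (by fun_prop)
  refine ContDiffOn.contDiffAt hF (Filter.mem_of_superset (ho.mem_nhds hp) ?_)
  intro q hq
  have hq' : 0 < q 2 := hq
  refine ⟨hq'.le, ?_⟩
  rintro rfl
  simp at hq'

/-- The solutions of the Robin problem with spectral parameter `lam` in the `m`-th sector. -/
def eigenspace (σ lam : ℝ) (m : ℕ) : Submodule ℂ (Hemisphere → ℂ) where
  carrier := {F | SolvesRobin σ lam F ∧ InSector m F}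
  zero_mem' := by
    refine ⟨⟨?_, ?_, ?_⟩, ?_⟩
    · unfold IsC2
      rw [radialExt_zero]
      exact contDiffOn_const
    · intro p _
      unfold sphericalLaplacian
      rw [radialExt_zero]
      have h : Δ (0 : E3 → ℂ) p.1 = 0 :=
        congrFun (InnerProductSpace.laplacian_const (E := E3) (c := (0 : ℂ))) p.1
      rw [h]
      simp
    · intro p _
      refine ⟨0, ?_, by simp⟩
      unfold HasOutwardNormalDeriv
      rw [radialExt_zero]
      simpa using hasDerivWithinAt_const (0 : ℝ) (Set.Ici (0 : ℝ)) (0 : ℂ)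
    · intro φ p
      simp
  add_mem' := by
    rintro F G ⟨hF, hF'⟩ ⟨hG, hG'⟩
    refine ⟨⟨?_, ?_, ?_⟩, ?_⟩
    · unfold IsC2
      rw [radialExt_add]
      exact ContDiffOn.add hF.isC2 hG.isC2
    · intro p hp
      have h1 := hF.eqn p hp
      have h2 := hG.eqn p hp
      unfold sphericalLaplacian at h1 h2 ⊢
      rw [radialExt_add, (hF.isC2.contDiffAt p hp).laplacian_add (hG.isC2.contDiffAt p hp)]
      simp only [Pi.add_apply]
      linear_combination h1 + h2
    · intro p hp
      obtain ⟨v, hv, hv'⟩ := hF.bdry p hp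
      obtain ⟨w, hw, hw'⟩ := hG.bdry p hp
      refine ⟨v + w, ?_, ?_⟩
      · unfold HasOutwardNormalDeriv at hv hw ⊢
        rw [radialExt_add, neg_add]
        exact hv.add hw
      · simp only [Pi.add_apply]
        linear_combination hv' + hw'
    · intro φ p
      simp only [Pi.add_apply, hF' φ p, hG' φ p, mul_add]
  smul_mem' := by
    rintro c F ⟨hF, hF'⟩
    refine ⟨⟨?_, ?_, ?_⟩, ?_⟩
    · unfold IsC2
      rw [radialExt_smul]
      exact ContDiffOn.const_smul c hF.isC2
    · intro p hp
      have h1 := hF.eqn p hp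
      unfold sphericalLaplacian at h1 ⊢
      rw [radialExt_smul, InnerProductSpace.laplacian_smul c (hF.isC2.contDiffAt p hp)]
      simp only [Pi.smul_apply, smul_eq_mul]
      linear_combination c * h1
    · intro p hp
      obtain ⟨v, hv, hv'⟩ := hF.bdry p hp
      refine ⟨c * v, ?_, ?_⟩
      · unfold HasOutwardNormalDeriv at hv ⊢
        rw [radialExt_smul, ← mul_neg]
        exact hv.const_smul c
      · simp only [Pi.smul_apply, smul_eq_mul]
        linear_combination c * hv'
    · intro φ p
      simp only [Pi.smul_apply, smul_eq_mul, hF' φ p]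
      ring

/-- The number of desymmetrized Robin eigenvalues `≤ t`, with multiplicities: an eigenvalue `s` is
counted `∑ m ≥ 0, dim (eigenspace σ s m)` times. A triple `(s, m, k)` stands for the `k`-th basis
vector of `eigenspace σ s m`. -/
def counting (σ t : ℝ) : ℕ∞ :=
  Set.encard {q : ℝ × ℕ × ℕ | q.1 ≤ t ∧ (q.2.2 : Cardinal) < Module.rank ℂ (eigenspace σ q.1 q.2.1)}

/-- The ordered desymmetrized Robin eigenvalues `λ_0(σ) ≤ λ_1(σ) ≤ …` of the hemisphere, repeated
with multiplicity. -/
def eigenvalue (σ : ℝ) (n : ℕ) : ℝ := sInf {t : ℝ | (n : ℕ∞) < counting σ t}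

/-- The Robin-Neumann gaps `d_n(σ) = λ_n(σ) - λ_n(0)`. -/
def gap (σ : ℝ) (n : ℕ) : ℝ := eigenvalue σ n - eigenvalue 0 n

/-- The secular function `S_m(ν)`. -/
def secular (m : ℕ) (ν : ℝ) : ℝ :=
  2 * Real.tan (Real.pi * (m + ν) / 2) *
    (Real.Gamma ((ν + m) / 2 + 1) * Real.Gamma ((ν - m) / 2 + 1) /
      (Real.Gamma ((ν + m + 1) / 2) * Real.Gamma ((ν - m + 1) / 2)))

/-- The cluster `E_ℓ(σ)` of all `ν (ν + 1)`, where `ν` is the solution of `S_m(ν) = σ` in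
`(ℓ, ℓ + 1)` and `m` runs over `0 ≤ m ≤ ℓ`, `m ≡ ℓ mod 2`. -/
def cluster (σ : ℝ) (l : ℕ) : Set ℝ :=
  {x | ∃ (m : ℕ) (ν : ℝ), m ≤ l ∧ m ≡ l [MOD 2] ∧ ν ∈ Set.Ioo (l : ℝ) (l + 1) ∧
    secular m ν = σ ∧ x = ν * (ν + 1)}

/-- The mean of the Robin-Neumann gaps over the cluster `E_ℓ(σ)`. -/
def clusterMean (σ : ℝ) (l : ℕ) : ℝ :=
  (1 / ((cluster σ l).ncard : ℝ)) * ∑ᶠ (n : ℕ) (_ : eigenvalue σ n ∈ cluster σ l), gap σ n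

/-- The area of the hemisphere, for the surface measure of the unit sphere. -/
def area : ℝ :=
  (MeasureTheory.volume : MeasureTheory.Measure E3).toSphere.real {p | 0 ≤ (p : E3) 2}

/-- The length of the equator, as the integral of the speed of a parametrization. -/
def boundaryLength : ℝ :=
  ∫ φ in (0 : ℝ)..(2 * Real.pi), ‖deriv (fun s : ℝ => (!₂[Real.cos s, Real.sin s, 0] : E3)) φ‖

end

end RobinHemisphere

namespace RobinHemisphere

open Filter Topology

/-- The quotient `Γ(x + 1/2) / Γ(x)`. -/
noncomputable def gammaQuot (x : ℝ) : ℝ := Real.Gamma (x + 1 / 2) / Real.Gamma x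

theorem gammaQuot_pos {x : ℝ} (hx : 0 < x) : 0 < gammaQuot x :=
  div_pos (Real.Gamma_pos_of_pos (by linarith)) (Real.Gamma_pos_of_pos hx)

theorem gammaQuot_mono {x y : ℝ} (hx : 0 < x) (hxy : x ≤ y) : gammaQuot x ≤ gammaQuot y := by
  rcases hxy.eq_or_lt with rfl | hlt
  · exact le_rfl
  have hy : 0 < y := hx.trans hlt
  have hd : 0 < y - x + 1 / 2 := by linarith
  have hyx : 0 < y - x := by linarith
  set a := (y - x) / (y - x + 1 / 2) with ha
  set b := (1 / 2) / (y - x + 1 / 2) with hb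
  have ha0 : 0 < a := by positivity
  have hb0 : 0 < b := by positivity
  have hab : a + b = 1 := by rw [ha, hb]; field_simp
  have hy2 : 0 < y + 1 / 2 := by linarith
  have h1 := Real.Gamma_mul_add_mul_le_rpow_Gamma_mul_rpow_Gamma hx hy2 ha0 hb0 hab
  have h2 := Real.Gamma_mul_add_mul_le_rpow_Gamma_mul_rpow_Gamma hx hy2 hb0 ha0
    (by rw [add_comm]; exact hab)
  have e1 : a * x + b * (y + 1 / 2) = x + 1 / 2 := by
    rw [ha, hb]; field_simp; ring
  have e2 : b * x + a * (y + 1 / 2) = y := by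
    rw [ha, hb]; field_simp; ring
  rw [e1] at h1
  rw [e2] at h2
  have p1 := Real.Gamma_pos_of_pos hx
  have p2 := Real.Gamma_pos_of_pos hy2
  have p3 := Real.Gamma_pos_of_pos hy
  have p4 := Real.Gamma_pos_of_pos (show 0 < x + 1 / 2 by linarith)
  unfold gammaQuot
  rw [div_le_div_iff₀ p1 p3]
  calc Real.Gamma (x + 1 / 2) * Real.Gamma y
      ≤ (Real.Gamma x ^ a * Real.Gamma (y + 1 / 2) ^ b) *
        (Real.Gamma x ^ b * Real.Gamma (y + 1 / 2) ^ a) :=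
        mul_le_mul h1 h2 p3.le (by positivity)
    _ = Real.Gamma x ^ (a + b) * Real.Gamma (y + 1 / 2) ^ (a + b) := by
        rw [Real.rpow_add p1, Real.rpow_add p2]; ring
    _ = Real.Gamma (y + 1 / 2) * Real.Gamma x := by
        rw [hab, Real.rpow_one, Real.rpow_one, mul_comm]

theorem gammaQuot_mul_gammaQuot_add_half {x : ℝ} (hx : 0 < x) :
    gammaQuot x * gammaQuot (x + 1 / 2) = x := by
  have p1 := Real.Gamma_pos_of_pos hx
  have p4 := Real.Gamma_pos_of_pos (show 0 < x + 1 / 2 by linarith)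
  unfold gammaQuot
  rw [show x + 1 / 2 + 1 / 2 = x + 1 by ring, Real.Gamma_add_one hx.ne']
  field_simp

theorem gammaQuot_add_one {x : ℝ} (hx : 0 < x) :
    gammaQuot (x + 1) = gammaQuot x * ((x + 1 / 2) / x) := by
  have p1 := Real.Gamma_pos_of_pos hx
  have p4 := Real.Gamma_pos_of_pos (show 0 < x + 1 / 2 by linarith)
  unfold gammaQuot
  rw [show x + 1 + 1 / 2 = x + 1 / 2 + 1 by ring, Real.Gamma_add_one hx.ne',
    Real.Gamma_add_one (by linarith)]
  field_simp

theorem le_gammaQuot_add_half_sq {x : ℝ} (hx : 0 < x) : x ≤ gammaQuot (x + 1 / 2) ^ 2 := by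
  have h := gammaQuot_mul_gammaQuot_add_half hx
  have h2 := gammaQuot_mono hx (show x ≤ x + 1 / 2 by linarith)
  have h3 := gammaQuot_pos (show 0 < x + 1 / 2 by linarith)
  nlinarith

theorem gammaQuot_half : gammaQuot (1 / 2) = (√Real.pi)⁻¹ := by
  unfold gammaQuot
  rw [Real.Gamma_one_half_eq]
  norm_num

theorem gammaQuot_add_le {b s : ℝ} (hb : 1 / 2 ≤ b) (hs : 0 < s) (hs1 : s < 1) :
    gammaQuot (b + s) ≤ gammaQuot b * (1 + 3 * s) := by
  have hb0 : 0 < b := by linarith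
  have q1 := Real.Gamma_pos_of_pos hb0
  have q2 := Real.Gamma_pos_of_pos (show 0 < b + 1 / 2 by linarith)
  have q3 := Real.Gamma_pos_of_pos (show 0 < b + s by linarith)
  have h1 := Real.Gamma_mul_add_mul_le_rpow_Gamma_mul_rpow_Gamma (show 0 < b + 1 / 2 by linarith)
    (show 0 < b + 1 / 2 + 1 by linarith) (show 0 < 1 - s by linarith) hs (by ring)
  rw [show (1 - s) * (b + 1 / 2) + s * (b + 1 / 2 + 1) = b + s + 1 / 2 by ring,
    Real.Gamma_add_one (by linarith), Real.mul_rpow (by linarith) q2.le, mul_left_comm,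
    ← Real.rpow_add q2, sub_add_cancel, Real.rpow_one] at h1
  have h2 := Real.Gamma_mul_add_mul_le_rpow_Gamma_mul_rpow_Gamma (show 0 < b + s by linarith)
    (show 0 < b + s + 1 by linarith) hs (show 0 < 1 - s by linarith) (by ring)
  rw [show s * (b + s) + (1 - s) * (b + s + 1) = b + 1 by ring,
    Real.Gamma_add_one hb0.ne', Real.Gamma_add_one (by linarith),
    Real.mul_rpow (by linarith) q3.le, mul_left_comm,
    ← Real.rpow_add q3, add_sub_cancel, Real.rpow_one] at h2
  have h3 := Real.geom_mean_le_arith_mean2_weighted hs.le (show 0 ≤ 1 - s by linarith)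
    (show 0 ≤ b + 1 / 2 by linarith) (show 0 ≤ b + s by linarith) (by ring)
  have h4 : s * (b + 1 / 2) + (1 - s) * (b + s) ≤ b * (1 + 3 * s) := by nlinarith
  unfold gammaQuot
  rw [div_le_iff₀ q3]
  have hA : 0 ≤ (b + 1 / 2) ^ s := by positivity
  have key : Real.Gamma (b + s + 1 / 2) * (b * Real.Gamma b) ≤
      Real.Gamma (b + 1 / 2) * Real.Gamma (b + s) * (b * (1 + 3 * s)) := by
    calc Real.Gamma (b + s + 1 / 2) * (b * Real.Gamma b)
        ≤ ((b + 1 / 2) ^ s * Real.Gamma (b + 1 / 2)) * ((b + s) ^ (1 - s) * Real.Gamma (b + s)) :=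
          mul_le_mul h1 h2 (by positivity) (by positivity)
      _ = Real.Gamma (b + 1 / 2) * Real.Gamma (b + s) * ((b + 1 / 2) ^ s * (b + s) ^ (1 - s)) := by
          ring
      _ ≤ _ := mul_le_mul_of_nonneg_left (h3.trans h4) (by positivity)
  rw [div_mul_eq_mul_div, div_mul_eq_mul_div, le_div_iff₀ q1]
  nlinarith

theorem continuousAt_gammaQuot {x : ℝ} (hx : 0 < x) : ContinuousAt gammaQuot x := by
  have hG : ∀ y : ℝ, 0 < y → ContinuousAt Real.Gamma y := fun y hy =>
    (Real.differentiableAt_Gamma fun m => by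
      have : (0 : ℝ) ≤ m := m.cast_nonneg
      linarith).continuousAt
  have h1 : ContinuousAt (fun y : ℝ => Real.Gamma (y + 1 / 2)) x :=
    ContinuousAt.comp (f := fun y : ℝ => y + 1 / 2) (hG (x + 1 / 2) (by linarith)) (by fun_prop)
  exact h1.div (hG x hx) (Real.Gamma_pos_of_pos hx).ne'

/-- The Gamma factor of the secular function. -/
noncomputable def secularFactor (m : ℕ) (ν : ℝ) : ℝ :=
  gammaQuot ((ν + m + 1) / 2) * gammaQuot ((ν - m + 1) / 2)

theorem secular_eq_tan_mul (m : ℕ) (ν : ℝ) :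
    secular m ν = 2 * Real.tan (Real.pi * (m + ν) / 2) * secularFactor m ν := by
  unfold secular secularFactor gammaQuot
  rw [show (ν + m + 1) / 2 + 1 / 2 = (ν + m) / 2 + 1 by ring,
    show (ν - m + 1) / 2 + 1 / 2 = (ν - m) / 2 + 1 by ring, div_mul_div_comm]

theorem secular_eq_of_modEq {m l : ℕ} (h : m ≡ l [MOD 2]) (ν : ℝ) :
    secular m ν = 2 * Real.tan (Real.pi * (ν - l) / 2) * secularFactor m ν := by
  rw [secular_eq_tan_mul]
  obtain ⟨k, hk⟩ : ∃ k : ℕ, m + l = 2 * k := by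
    have : (m + l) % 2 = 0 := by
      unfold Nat.ModEq at h
      omega
    exact ⟨(m + l) / 2, by omega⟩
  have hk' : (m : ℝ) + l = 2 * k := by exact_mod_cast hk
  rw [show Real.pi * (m + ν) / 2 = Real.pi * (ν - l) / 2 + k * Real.pi by
    linear_combination Real.pi / 2 * hk', Real.tan_add_nat_mul_pi]

theorem secularFactor_pos {m : ℕ} {ν : ℝ} (h : (m : ℝ) ≤ ν) : 0 < secularFactor m ν := by
  have : (0 : ℝ) ≤ m := m.cast_nonneg
  exact mul_pos (gammaQuot_pos (by linarith)) (gammaQuot_pos (by linarith))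

theorem secularFactor_mono {m : ℕ} {ν μ : ℝ} (h : (m : ℝ) ≤ ν) (h2 : ν ≤ μ) :
    secularFactor m ν ≤ secularFactor m μ := by
  have : (0 : ℝ) ≤ m := m.cast_nonneg
  exact mul_le_mul (gammaQuot_mono (by linarith) (by linarith))
    (gammaQuot_mono (by linarith) (by linarith)) (gammaQuot_pos (by linarith)).le
    (gammaQuot_pos (by linarith)).le

theorem continuousOn_secularFactor (m : ℕ) : ContinuousOn (secularFactor m) (Set.Ici (m : ℝ)) := by
  intro ν hν
  have hν' : (m : ℝ) ≤ ν := hν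
  have : (0 : ℝ) ≤ m := m.cast_nonneg
  refine ContinuousAt.continuousWithinAt (ContinuousAt.mul ?_ ?_)
  · exact ContinuousAt.comp (f := fun ν : ℝ => (ν + m + 1) / 2)
      (continuousAt_gammaQuot (by linarith)) (by fun_prop)
  · exact ContinuousAt.comp (f := fun ν : ℝ => (ν - m + 1) / 2)
      (continuousAt_gammaQuot (by linarith)) (by fun_prop)

theorem tan_half_pi_pos {l : ℕ} {ν : ℝ} (hν : ν ∈ Set.Ioo (l : ℝ) (l + 1)) :
    0 < Real.tan (Real.pi * (ν - l) / 2) :=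
  Real.tan_pos_of_pos_of_lt_pi_div_two
    (by have := Real.pi_pos; have := hν.1; have : 0 < ν - l := by linarith
        positivity)
    (by have := Real.pi_pos; have := hν.2; nlinarith)

theorem secular_strictMono {m l : ℕ} (hm : m ≤ l) (h : m ≡ l [MOD 2]) {ν μ : ℝ}
    (hν : ν ∈ Set.Ioo (l : ℝ) (l + 1)) (hμ : μ ∈ Set.Ioo (l : ℝ) (l + 1)) (hlt : ν < μ) :
    secular m ν < secular m μ := by
  have hm' : (m : ℝ) ≤ l := by exact_mod_cast hm
  rw [secular_eq_of_modEq h, secular_eq_of_modEq h]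
  have h1 := tan_half_pi_pos hν
  have h2 := tan_half_pi_pos hμ
  have h3 : Real.tan (Real.pi * (ν - l) / 2) < Real.tan (Real.pi * (μ - l) / 2) := by
    have hp := Real.pi_pos
    apply Real.tan_lt_tan_of_lt_of_lt_pi_div_two
    · nlinarith [hν.1]
    · nlinarith [hμ.2]
    · nlinarith
  have h4 := secularFactor_mono (hm'.trans hν.1.le) hlt.le
  have h5 := secularFactor_pos (hm'.trans hν.1.le)
  nlinarith

theorem secularFactor_add_two_lt {m : ℕ} {ν : ℝ} (h : (m : ℝ) + 2 ≤ ν) :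
    secularFactor (m + 2) ν < secularFactor m ν := by
  have hm : (0 : ℝ) ≤ m := m.cast_nonneg
  unfold secularFactor
  have e1 : (ν + ((m + 2 : ℕ) : ℝ) + 1) / 2 = (ν + m + 1) / 2 + 1 := by push_cast; ring
  have e2 : (ν - m + 1) / 2 = (ν - ((m + 2 : ℕ) : ℝ) + 1) / 2 + 1 := by push_cast; ring
  have hb : 0 < (ν - ((m + 2 : ℕ) : ℝ) + 1) / 2 := by push_cast; linarith
  have ha : 0 < (ν + m + 1) / 2 := by linarith
  have hab : (ν - ((m + 2 : ℕ) : ℝ) + 1) / 2 < (ν + m + 1) / 2 := by push_cast; linarith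
  rw [e1, e2]
  set a := (ν + m + 1) / 2
  set b := (ν - ((m + 2 : ℕ) : ℝ) + 1) / 2
  rw [gammaQuot_add_one ha, gammaQuot_add_one hb]
  have h1 : (a + 1 / 2) / a < (b + 1 / 2) / b := by
    rw [div_lt_div_iff₀ ha hb]; nlinarith
  have := mul_pos (gammaQuot_pos ha) (gammaQuot_pos hb)
  nlinarith

theorem exists_secular_eq {σ : ℝ} (hσ : 0 < σ) {m l : ℕ} (hm : m ≤ l) (h : m ≡ l [MOD 2]) :
    ∃ ν ∈ Set.Ioo (l : ℝ) (l + 1), secular m ν = σ := by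
  have hm' : (m : ℝ) ≤ l := by exact_mod_cast hm
  have hp := Real.pi_pos
  set G := secularFactor m l
  have hG : 0 < G := secularFactor_pos hm'
  have hY : 0 < σ / (2 * G) := by positivity
  set n : ℝ → ℝ := fun y => l + 2 / Real.pi * Real.arctan y with hn
  have hnl : ∀ y, 0 ≤ y → (l : ℝ) ≤ n y := fun y hy => by
    have := Real.arctan_nonneg.2 hy
    have : 0 ≤ 2 / Real.pi * Real.arctan y := by positivity
    simp only [hn]; linarith
  have hcont : ContinuousOn (fun y => 2 * y * secularFactor m (n y)) (Set.Icc 0 (σ / (2 * G))) := by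
    refine ContinuousOn.mul (by fun_prop) ?_
    refine (continuousOn_secularFactor m).comp ?_ ?_
    · exact Continuous.continuousOn (by fun_prop)
    · intro y hy
      exact hm'.trans (hnl y hy.1)
  obtain ⟨y, hy, hyσ⟩ := intermediate_value_Icc hY.le hcont (show σ ∈ Set.Icc _ _ from ⟨by
    simpa using hσ.le, by
    have := secularFactor_mono hm' (hnl (σ / (2 * G)) hY.le)
    calc σ = 2 * (σ / (2 * G)) * G := by field_simp
      _ ≤ _ := mul_le_mul_of_nonneg_left this (by positivity)⟩)
  have hyσ' : 2 * y * secularFactor m (n y) = σ := hyσ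
  have hy0 : 0 < y := by
    rcases hy.1.eq_or_lt with h0 | h0
    · rw [← h0] at hyσ'; simp at hyσ'; linarith
    · exact h0
  have ha : 0 < Real.arctan y := Real.arctan_pos.2 hy0
  have ha2 := Real.arctan_lt_pi_div_two y
  refine ⟨n y, ⟨?_, ?_⟩, ?_⟩
  · have : 0 < 2 / Real.pi * Real.arctan y := by positivity
    simp only [hn]; linarith
  · have : 2 / Real.pi * Real.arctan y < 2 / Real.pi * (Real.pi / 2) :=
      mul_lt_mul_of_pos_left ha2 (by positivity)
    have e : 2 / Real.pi * (Real.pi / 2) = 1 := by field_simp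
    simp only [hn]; linarith
  · rw [secular_eq_of_modEq h, show Real.pi * (n y - l) / 2 = Real.arctan y by
      simp only [hn]; field_simp; ring, Real.tan_arctan]
    exact hyσ'

theorem le_of_secular_pos {m : ℕ} {ν : ℝ} (hm : (m : ℝ) ≤ ν) (h : 0 < secular m ν) :
    ∃ l : ℕ, m ≤ l ∧ m ≡ l [MOD 2] ∧ ν ∈ Set.Ioo (l : ℝ) (l + 1) := by
  have hm0 : (0 : ℝ) ≤ m := m.cast_nonneg
  have hν0 : 0 ≤ ν := hm0.trans hm
  have hF := secularFactor_pos hm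
  have hfl := Nat.floor_le hν0
  have hfl2 := Nat.lt_floor_add_one ν
  have hp := Real.pi_pos
  rcases (Nat.mod_two_eq_zero_or_one (m + ⌊ν⌋₊)) with h0 | h1
  · have hmod : m ≡ ⌊ν⌋₊ [MOD 2] := by unfold Nat.ModEq; omega
    refine ⟨⌊ν⌋₊, Nat.le_floor hm, hmod, lt_of_le_of_ne hfl ?_, hfl2⟩
    intro he
    rw [secular_eq_of_modEq hmod, he] at h
    simp at h
  · have hmod : m ≡ ⌊ν⌋₊ + 1 [MOD 2] := by unfold Nat.ModEq; omega
    rw [secular_eq_of_modEq hmod] at h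
    have ht : Real.tan (Real.pi * (ν - ((⌊ν⌋₊ + 1 : ℕ) : ℝ)) / 2) ≤ 0 := by
      apply Real.tan_nonpos_of_nonpos_of_neg_pi_div_two_le
      · push_cast; nlinarith
      · push_cast; nlinarith
    nlinarith

/-- The reciprocals `Γ(k + 1/2) / Γ(k + 1)`, the coefficients of `√π (1 - x)^(-1/2)`. -/
noncomputable def invQuot (k : ℕ) : ℝ := (gammaQuot (k + 1 / 2))⁻¹

theorem invQuot_pos (k : ℕ) : 0 < invQuot k := inv_pos.2 (gammaQuot_pos (by positivity))

theorem invQuot_zero : invQuot 0 = √Real.pi := by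
  simp [invQuot, gammaQuot_half, -one_div]

theorem invQuot_succ (k : ℕ) : (k + 1) * invQuot (k + 1) = (k + 1 / 2) * invQuot k := by
  unfold invQuot
  have h : (0 : ℝ) < k + 1 / 2 := by positivity
  have hg := gammaQuot_pos h
  rw [show ((k + 1 : ℕ) : ℝ) + 1 / 2 = k + 1 / 2 + 1 by push_cast; ring, gammaQuot_add_one h]
  field_simp
  ring

theorem invQuot_le_invQuot_zero (k : ℕ) : invQuot k ≤ √Real.pi := by
  rw [← invQuot_zero]
  unfold invQuot
  exact inv_anti₀ (gammaQuot_pos (by positivity))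
    (gammaQuot_mono (by positivity) (by simp))

theorem mul_invQuot_sq_le (k : ℕ) : k * invQuot k ^ 2 ≤ 1 := by
  rcases k.eq_zero_or_pos with rfl | hk
  · simp
  have hk' : (0 : ℝ) < k := by exact_mod_cast hk
  have h := le_gammaQuot_add_half_sq hk'
  unfold invQuot
  have := gammaQuot_pos (show (0 : ℝ) < k + 1 / 2 by positivity)
  rw [inv_pow, ← div_eq_mul_inv, div_le_one (by positivity)]
  exact h

theorem sum_antidiagonal_invQuot (n : ℕ) :
    ∑ p ∈ Finset.HasAntidiagonal.antidiagonal n, invQuot p.1 * invQuot p.2 = Real.pi := by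
  induction n with
  | zero => simp [invQuot_zero, Real.mul_self_sqrt Real.pi_pos.le]
  | succ n ih =>
    have swap : ∀ N : ℕ, ∑ p ∈ Finset.HasAntidiagonal.antidiagonal N, (p.2 : ℝ) * (invQuot p.1 * invQuot p.2) =
        ∑ p ∈ Finset.HasAntidiagonal.antidiagonal N, (p.1 : ℝ) * (invQuot p.1 * invQuot p.2) := by
      intro N
      rw [← Finset.Nat.sum_antidiagonal_swap]
      exact Finset.sum_congr rfl fun p _ => by simp [mul_comm]
    have tot : ∀ N : ℕ, (N : ℝ) * ∑ p ∈ Finset.HasAntidiagonal.antidiagonal N, invQuot p.1 * invQuot p.2 =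
        2 * ∑ p ∈ Finset.HasAntidiagonal.antidiagonal N, (p.1 : ℝ) * (invQuot p.1 * invQuot p.2) := by
      intro N
      rw [two_mul]
      nth_rw 1 [← swap N]
      rw [← Finset.sum_add_distrib, Finset.mul_sum]
      refine Finset.sum_congr rfl fun p hp => ?_
      have : (p.1 : ℝ) + p.2 = N := by exact_mod_cast Finset.HasAntidiagonal.mem_antidiagonal.1 hp
      rw [← this]; ring
    have h1 := tot (n + 1)
    rw [Finset.Nat.sum_antidiagonal_succ (f := fun p => (p.1 : ℝ) * (invQuot p.1 * invQuot p.2))]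
      at h1
    have h2 : ∑ p ∈ Finset.HasAntidiagonal.antidiagonal n,
        ((p.1 + 1 : ℕ) : ℝ) * (invQuot (p.1 + 1) * invQuot p.2) =
        ∑ p ∈ Finset.HasAntidiagonal.antidiagonal n, (p.1 : ℝ) * (invQuot p.1 * invQuot p.2) +
          1 / 2 * ∑ p ∈ Finset.HasAntidiagonal.antidiagonal n, invQuot p.1 * invQuot p.2 := by
      rw [Finset.mul_sum, ← Finset.sum_add_distrib]
      refine Finset.sum_congr rfl fun p _ => ?_
      have := invQuot_succ p.1
      push_cast
      linear_combination invQuot p.2 * this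
    simp only [Nat.cast_zero, zero_mul, zero_add] at h1
    rw [h2, mul_add, ← tot n, ih] at h1
    have hn : ((n + 1 : ℕ) : ℝ) ≠ 0 := by positivity
    apply mul_left_cancel₀ hn
    rw [h1]
    push_cast
    ring

theorem inv_secularFactor_nat {l k : ℕ} (hk : 2 * k ≤ l) :
    (secularFactor (l - 2 * k) l)⁻¹ = invQuot k * invQuot (l - k) := by
  unfold secularFactor invQuot
  rw [mul_inv, mul_comm]
  congr 3
  · rw [Nat.cast_sub hk]; push_cast; ring
  · rw [Nat.cast_sub hk, Nat.cast_sub (by omega)]; push_cast; ring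

theorem invQuot_mul_le {l k : ℕ} (hk : 2 * k ≤ l) (hl : 1 ≤ l) :
    invQuot k * invQuot (l - k) ≤ 3 / √l := by
  have hl' : (0 : ℝ) < l := by exact_mod_cast hl
  have h1 := invQuot_le_invQuot_zero k
  have h2 := mul_invQuot_sq_le (l - k)
  have h3 : (l : ℝ) ≤ 2 * ((l - k : ℕ) : ℝ) := by
    have : l ≤ 2 * (l - k) := by omega
    exact_mod_cast this
  have hp := invQuot_pos k
  have hq := invQuot_pos (l - k)
  rw [le_div_iff₀ (Real.sqrt_pos.2 hl')]
  refine abs_le_of_sq_le_sq' ?_ (by norm_num) |>.2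
  rw [mul_pow, mul_pow, Real.sq_sqrt hl'.le]
  have h4 : invQuot k ^ 2 ≤ Real.pi := by
    calc invQuot k ^ 2 ≤ √Real.pi ^ 2 := by gcongr
      _ = _ := Real.sq_sqrt Real.pi_pos.le
  have h5 : invQuot (l - k) ^ 2 * l ≤ 2 := by nlinarith [sq_nonneg (invQuot (l - k))]
  have h6 := Real.pi_lt_four
  have : 0 ≤ invQuot (l - k) ^ 2 * l := by positivity
  calc _ = invQuot k ^ 2 * (invQuot (l - k) ^ 2 * l) := by ring
    _ ≤ 4 * 2 := mul_le_mul (h4.trans h6.le) h5 this (by norm_num)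
    _ ≤ _ := by norm_num

theorem sum_half_invQuot (l : ℕ) :
    2 * ∑ k ∈ Finset.range (l / 2 + 1), invQuot k * invQuot (l - k) =
      Real.pi + if l % 2 = 0 then invQuot (l / 2) ^ 2 else 0 := by
  have h := sum_antidiagonal_invQuot l
  rw [Finset.Nat.sum_antidiagonal_eq_sum_range_succ_mk] at h
  simp only at h
  set f : ℕ → ℝ := fun k => invQuot k * invQuot (l - k) with hf
  have hsym : ∀ k ≤ l, f (l - k) = f k := fun k hk => by
    simp only [hf]; rw [Nat.sub_sub_self hk, mul_comm]
  have hs : ∑ k ∈ Finset.range (l + 1), f k =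
      ∑ k ∈ Finset.range (l / 2 + 1), f k + ∑ k ∈ Finset.range (l - l / 2), f k := by
    have e : l + 1 = (l / 2 + 1) + (l - l / 2) := by omega
    rw [e, Finset.sum_range_add]
    congr 1
    rw [← Finset.sum_range_reflect]
    refine Finset.sum_congr rfl fun k hk => ?_
    have hk' := Finset.mem_range.1 hk
    rw [← hsym _ (by omega)]
    congr 1
    omega
  change 2 * ∑ k ∈ Finset.range (l / 2 + 1), f k = _
  change ∑ k ∈ Finset.range (l + 1), f k = _ at h
  rw [hs] at h
  split_ifs with h0
  · rw [show l - l / 2 = l / 2 by omega] at h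
    have e2 : f (l / 2) = invQuot (l / 2) ^ 2 := by
      simp only [hf]; rw [show l - l / 2 = l / 2 by omega, sq]
    rw [Finset.sum_range_succ] at h ⊢
    linarith
  · rw [show l - l / 2 = l / 2 + 1 by omega] at h
    linarith

theorem mul_one_sub_le_of_tan {x : ℝ} (h0 : 0 < x) (h1 : x < Real.pi / 2) :
    Real.tan x * (1 - Real.tan x) ≤ x := by
  have hc := Real.cos_pos_of_mem_Ioo ⟨by linarith, h1⟩
  have h2 := Real.lt_tan h0 h1
  have h3 := Real.one_sub_sq_div_two_le_cos (x := x)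
  have h4 : 1 - x ≤ Real.cos x := by have := Real.pi_lt_four; nlinarith
  have h5 := Real.sin_lt h0
  have ht : 0 < Real.tan x := h0.trans h2
  calc Real.tan x * (1 - Real.tan x) ≤ Real.tan x * Real.cos x := by
        apply mul_le_mul_of_nonneg_left _ ht.le; linarith
    _ = Real.sin x := Real.tan_mul_cos hc.ne'
    _ ≤ x := h5.le

theorem root_bounds {σ : ℝ} (hσ : 0 < σ) {m l : ℕ} (hm : m ≤ l) (h : m ≡ l [MOD 2]) {ν : ℝ}
    (hν : ν ∈ Set.Ioo (l : ℝ) (l + 1)) (hs : secular m ν = σ) :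
    ν - l ≤ σ / Real.pi * (secularFactor m l)⁻¹ ∧
      σ / Real.pi * (secularFactor m l)⁻¹ - σ ^ 2 / 2 * (secularFactor m l)⁻¹ ^ 2 ≤ ν - l := by
  have hm' : (m : ℝ) ≤ l := by exact_mod_cast hm
  have hm0 : (0 : ℝ) ≤ m := m.cast_nonneg
  have hp := Real.pi_pos
  have hp3 := Real.pi_gt_three
  have hG := secularFactor_pos hm'
  have hGν := secularFactor_pos (hm'.trans hν.1.le)
  have hmono := secularFactor_mono hm' hν.1.le
  have hup : secularFactor m ν ≤ secularFactor m l * (1 + 3 / 2 * (ν - l)) ^ 2 := by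
    have hs0 : 0 < (ν - l) / 2 := by linarith [hν.1]
    have hs1 : (ν - l) / 2 < 1 := by linarith [hν.2]
    have g1 := gammaQuot_add_le (b := ((l : ℝ) + m + 1) / 2) (by linarith) hs0 hs1
    have g2 := gammaQuot_add_le (b := ((l : ℝ) - m + 1) / 2) (by linarith) hs0 hs1
    rw [show ((l : ℝ) + m + 1) / 2 + (ν - l) / 2 = (ν + m + 1) / 2 by ring] at g1
    rw [show ((l : ℝ) - m + 1) / 2 + (ν - l) / 2 = (ν - m + 1) / 2 by ring] at g2
    have p1 := gammaQuot_pos (show 0 < ((l : ℝ) + m + 1) / 2 by linarith)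
    have p2 := gammaQuot_pos (show 0 < (ν - m + 1) / 2 by linarith [hν.1])
    calc secularFactor m ν ≤ _ := mul_le_mul g1 g2 p2.le (by positivity)
      _ = _ := by unfold secularFactor; ring
  rw [secular_eq_of_modEq h] at hs
  have hy := tan_half_pi_pos hν
  set δ := ν - l with hδ
  have hδ0 : 0 < δ := by linarith [hν.1]
  have hδ1 : δ < 1 := by linarith [hν.2]
  set y := Real.tan (Real.pi * δ / 2) with hydef
  set G := secularFactor m l
  set G' := secularFactor m ν
  have hx0 : 0 < Real.pi * δ / 2 := by positivity
  have hx1 : Real.pi * δ / 2 < Real.pi / 2 := by nlinarith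
  have hlt := Real.lt_tan hx0 hx1
  have hge := mul_one_sub_le_of_tan hx0 hx1
  rw [← hydef] at hlt hge
  set Y := σ / 2 * G⁻¹ with hY
  have hYG : 2 * Y * G = σ := by rw [hY]; field_simp
  have hY0 : 0 < Y := by positivity
  have hyY : y ≤ Y := by
    by_contra hcon
    push Not at hcon
    have a1 := mul_lt_mul_of_pos_right hcon hG
    have a2 := mul_le_mul_of_nonneg_left hmono hy.le
    linarith
  have hYy : Y ≤ y * (1 + 3 / 2 * δ) ^ 2 := by
    have : 2 * Y * G ≤ 2 * (y * (1 + 3 / 2 * δ) ^ 2) * G := by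
      calc 2 * Y * G = 2 * y * G' := by rw [hYG, hs]
        _ ≤ 2 * y * (G * (1 + 3 / 2 * δ) ^ 2) := by gcongr
        _ = _ := by ring
    have := le_of_mul_le_mul_right this hG
    linarith
  have hYy2 : Y * (1 - 3 * δ) ≤ y := by
    rcases le_or_gt (1 - 3 * δ) 0 with hn | hn
    · nlinarith
    have h1 : (1 + 3 / 2 * δ) ^ 2 * (1 - 3 * δ) ≤ 1 := by
      have e : (1 + 3 / 2 * δ) ^ 2 * (1 - 3 * δ) = 1 - (27 / 4 * δ ^ 2 + 27 / 4 * δ ^ 3) := by ring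
      have : 0 < 27 / 4 * δ ^ 2 + 27 / 4 * δ ^ 3 := by positivity
      linarith
    calc Y * (1 - 3 * δ) ≤ y * (1 + 3 / 2 * δ) ^ 2 * (1 - 3 * δ) := by gcongr
      _ = y * ((1 + 3 / 2 * δ) ^ 2 * (1 - 3 * δ)) := by ring
      _ ≤ y * 1 := by gcongr
      _ = y := mul_one y
  have e1 : σ / Real.pi * G⁻¹ = 2 / Real.pi * Y := by rw [hY]; field_simp
  have e2 : σ ^ 2 / 2 * G⁻¹ ^ 2 = 2 * Y ^ 2 := by rw [hY]; ring
  rw [e1, e2]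
  have hδY : δ ≤ 2 / Real.pi * Y := by
    rw [div_mul_eq_mul_div, le_div_iff₀ hp]; linarith
  refine ⟨hδY, ?_⟩
  have hδY' : δ ≤ 2 / 3 * Y := by
    refine hδY.trans ?_
    gcongr
  have h7 : Y - 3 * Y ^ 2 ≤ Real.pi * δ / 2 := by
    have a1 := mul_le_mul_of_nonneg_left hδY' hY0.le
    have a2 : y * y ≤ Y * Y := mul_le_mul hyY hyY hy.le hY0.le
    linarith
  have h8 : 2 / Real.pi * (Y - 3 * Y ^ 2) ≤ δ := by
    rw [div_mul_eq_mul_div, div_le_iff₀ hp]; linarith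
  have h9 : 2 / Real.pi * (3 * Y ^ 2) ≤ 2 / 3 * (3 * Y ^ 2) := by gcongr
  rw [mul_sub] at h8
  linarith

theorem mean_bound {σ : ℝ} (hσ : 0 < σ) : ∃ C : ℝ, ∀ l : ℕ, 1 ≤ l → ∀ ν : ℕ → ℝ,
    (∀ k ≤ l / 2, ν k ∈ Set.Ioo (l : ℝ) (l + 1) ∧ secular (l - 2 * k) (ν k) = σ) →
    |1 / ((l / 2 + 1 : ℕ) : ℝ) *
      ∑ k ∈ Finset.range (l / 2 + 1), (ν k * (ν k + 1) - l * (l + 1)) - 2 * σ| ≤ C / √l := by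
  refine ⟨100 * σ ^ 2 + 100 * σ, fun l hl ν hν => ?_⟩
  have hl' : (1 : ℝ) ≤ l := by exact_mod_cast hl
  have hp := Real.pi_pos
  have hp3 := Real.pi_gt_three
  have hp4 := Real.pi_lt_four
  set L := l / 2 with hL
  have hL1 : (l : ℝ) ≤ 2 * L + 1 := by
    have : l ≤ 2 * L + 1 := by omega
    exact_mod_cast this
  have hL2 : 2 * (L : ℝ) ≤ l := by
    have : 2 * L ≤ l := by omega
    exact_mod_cast this
  have hq : 0 < √(l : ℝ) := Real.sqrt_pos.2 (by linarith)
  have hq1 : 1 ≤ √(l : ℝ) := Real.one_le_sqrt.2 hl'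
  have hqq : √(l : ℝ) * √(l : ℝ) = l := Real.mul_self_sqrt (by linarith)
  set q := √(l : ℝ)
  set g : ℕ → ℝ := fun k => invQuot k * invQuot (l - k) with hg
  have hg0 : ∀ k, 0 < g k := fun k => mul_pos (invQuot_pos _) (invQuot_pos _)
  set s := ∑ k ∈ Finset.range (L + 1), g k with hs
  have hs_bd : Real.pi / 2 ≤ s ∧ s ≤ Real.pi / 2 + 1 / l := by
    have h := sum_half_invQuot l
    change 2 * s = _ at h
    split_ifs at h with h0
    · have hsq := mul_invQuot_sq_le (l / 2)
      have e : ((l / 2 : ℕ) : ℝ) = l / 2 := by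
        rw [Nat.cast_div (Nat.dvd_of_mod_eq_zero h0) (by norm_num)]; norm_num
      rw [e] at hsq
      have h2 : invQuot (l / 2) ^ 2 ≤ 2 / l := by
        rw [le_div_iff₀ (by linarith)]; linarith
      have h3 : (2 : ℝ) / l = 2 * (1 / l) := by ring
      have := sq_nonneg (invQuot (l / 2))
      constructor <;> linarith
    · have : (0 : ℝ) < 1 / l := by positivity
      constructor <;> linarith
  have hl1 : (1 : ℝ) / l ≤ 1 / q := by
    apply one_div_le_one_div_of_le hq; nlinarith
  have hl2 : (1 : ℝ) / l ≤ 1 := by rw [div_le_one (by linarith)]; exact hl'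
  have hs2 : ∑ k ∈ Finset.range (L + 1), g k ^ 2 ≤ 9 / q := by
    calc ∑ k ∈ Finset.range (L + 1), g k ^ 2
        ≤ ∑ k ∈ Finset.range (L + 1), 3 / q * g k := by
          refine Finset.sum_le_sum fun k hk => ?_
          have hk' := Finset.mem_range.1 hk
          rw [sq]
          exact mul_le_mul_of_nonneg_right (invQuot_mul_le (by omega) hl) (hg0 k).le
      _ = 3 / q * s := by rw [hs, Finset.mul_sum]
      _ ≤ 3 / q * 3 := by
          apply mul_le_mul_of_nonneg_left _ (by positivity); linarith [hs_bd.2]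
      _ = 9 / q := by ring
  have hδ : ∀ k ∈ Finset.range (L + 1), ν k - l ≤ σ / Real.pi * g k ∧
      σ / Real.pi * g k - σ ^ 2 / 2 * g k ^ 2 ≤ ν k - l ∧ 0 < ν k - l := by
    intro k hk
    have hk' := Finset.mem_range.1 hk
    obtain ⟨h1, h2⟩ := hν k (by omega)
    have hmod : l - 2 * k ≡ l [MOD 2] := by unfold Nat.ModEq; omega
    have h3 := root_bounds hσ (by omega) hmod h1 h2
    rw [inv_secularFactor_nat (by omega)] at h3
    exact ⟨h3.1, h3.2, by linarith [h1.1]⟩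
  set T := ∑ k ∈ Finset.range (L + 1), (ν k * (ν k + 1) - l * (l + 1)) with hT
  have hTup : T ≤ (2 * l + 1) * (σ / Real.pi * s) + σ ^ 2 * (9 / q) := by
    calc T ≤ ∑ k ∈ Finset.range (L + 1),
          ((2 * l + 1) * (σ / Real.pi * g k) + σ ^ 2 * g k ^ 2) := by
          refine Finset.sum_le_sum fun k hk => ?_
          obtain ⟨h1, -, h3⟩ := hδ k hk
          have h4 : (ν k - l) ^ 2 ≤ σ ^ 2 * g k ^ 2 := by
            rw [← mul_pow]
            have : σ / Real.pi * g k ≤ σ * g k := by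
              apply mul_le_mul_of_nonneg_right _ (hg0 k).le
              exact div_le_self hσ.le (by linarith)
            exact pow_le_pow_left₀ h3.le (h1.trans this) 2
          nlinarith
      _ = (2 * l + 1) * (σ / Real.pi * s) +
          σ ^ 2 * ∑ k ∈ Finset.range (L + 1), g k ^ 2 := by
          rw [Finset.sum_add_distrib, hs]; simp only [Finset.mul_sum]
      _ ≤ _ := by gcongr
  have hTlow : (2 * l + 1) * (σ / Real.pi * s) - (2 * l + 1) * (σ ^ 2 / 2 * (9 / q)) ≤ T := by
    calc (2 * l + 1) * (σ / Real.pi * s) - (2 * l + 1) * (σ ^ 2 / 2 * (9 / q))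
        ≤ (2 * l + 1) * (σ / Real.pi * s) -
          (2 * l + 1) * (σ ^ 2 / 2 * ∑ k ∈ Finset.range (L + 1), g k ^ 2) := by gcongr
      _ = ∑ k ∈ Finset.range (L + 1),
          ((2 * l + 1) * (σ / Real.pi * g k) - (2 * l + 1) * (σ ^ 2 / 2 * g k ^ 2)) := by
          rw [Finset.sum_sub_distrib, hs]; simp only [Finset.mul_sum]
      _ ≤ T := by
          refine Finset.sum_le_sum fun k hk => ?_
          obtain ⟨-, h2, h3⟩ := hδ k hk
          nlinarith
  have hN : ((L + 1 : ℕ) : ℝ) = L + 1 := by push_cast; ring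
  rw [hN]
  have hN0 : (0 : ℝ) < L + 1 := by positivity
  have hNl : (l : ℝ) ≤ 2 * (L + 1) := by linarith
  have hc1 : σ / Real.pi * s ≤ σ / 2 + σ / 3 * (1 / q) := by
    calc σ / Real.pi * s ≤ σ / Real.pi * (Real.pi / 2 + 1 / q) := by
          gcongr; linarith [hs_bd.2]
      _ = σ / 2 + σ / Real.pi * (1 / q) := by field_simp
      _ ≤ _ := by gcongr
  have hc2 : σ / 2 ≤ σ / Real.pi * s := by
    calc σ / 2 = σ / Real.pi * (Real.pi / 2) := by field_simp
      _ ≤ _ := by gcongr; exact hs_bd.1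
  set r := 1 / q with hr
  have hr0 : 0 < r := by positivity
  have hlr : 1 ≤ (l : ℝ) * r := by
    rw [hr, mul_one_div, le_div_iff₀ hq]; nlinarith
  have e9 : 9 / q = 9 * r := by rw [hr]; ring
  rw [e9] at hTup hTlow
  rw [show (100 * σ ^ 2 + 100 * σ) / q = (100 * σ ^ 2 + 100 * σ) * r by rw [hr]; ring]
  have hr1 : r ≤ 1 := by rw [hr, div_le_one hq]; exact hq1
  have key : |T - 2 * σ * (L + 1)| ≤ (100 * σ ^ 2 + 100 * σ) * r * (L + 1) := by
    have a1 : r * l ≤ r * (2 * (L + 1)) := by gcongr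
    have a2 : 1 ≤ r * (2 * (L + 1)) := by linarith [mul_comm (l : ℝ) r]
    have hσ2 : 0 < σ ^ 2 := by positivity
    have b1 : (2 * l + 1) * (σ / Real.pi * s) ≤ (2 * l + 1) * (σ / 2 + σ / 3 * r) := by gcongr
    have b2 : (2 * l + 1) * (σ / 2) ≤ (2 * l + 1) * (σ / Real.pi * s) := by gcongr
    have c1 := mul_le_mul_of_nonneg_left a1 hσ.le
    have c2 := mul_le_mul_of_nonneg_left a2 hσ.le
    have c3 := mul_le_mul_of_nonneg_left a1 hσ2.le
    have c4 := mul_le_mul_of_nonneg_left a2 hσ2.le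
    have d1 : r ≤ r * l := le_mul_of_one_le_right hr0.le hl'
    have d2 := mul_le_mul_of_nonneg_left d1 hσ.le
    have d3 := mul_le_mul_of_nonneg_left d1 hσ2.le
    have f1 := mul_le_mul_of_nonneg_left hL1 hσ.le
    have f2 := mul_le_mul_of_nonneg_left hL2 hσ.le
    rw [abs_le]
    generalize σ / Real.pi * s = X at *
    have g1 : 0 ≤ σ * r * (L + 1) := by positivity
    have g2 : 0 ≤ σ ^ 2 * r * (L + 1) := by positivity
    clear_value T L r q
    clear hs_bd hs2 hδ hν hl1 hl2 hL1 hL2 hl hq hq1 hqq e9 hg0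
    constructor <;> linarith
  have : 1 / ((L : ℝ) + 1) * T - 2 * σ = (T - 2 * σ * (L + 1)) / (L + 1) := by field_simp
  rw [this, abs_div, abs_of_pos hN0, div_le_iff₀ hN0]
  exact key

section PowerSeries

/-- The real power series with coefficients `c`. -/
noncomputable def powSum (c : ℕ → ℝ) (x : ℝ) : ℝ := ∑' k, c k * x ^ k

/-- The coefficients of the derivative of a power series. -/
def derivCoeff (c : ℕ → ℝ) (k : ℕ) : ℝ := (k + 1) * c (k + 1)

/-- The power series with coefficients `c` converges absolutely on `(-R, R)`. -/
def AbsConv (c : ℕ → ℝ) (R : ℝ) : Prop :=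
  ∀ r : ℝ, 0 ≤ r → r < R → Summable fun k => |c k| * r ^ k

variable {c : ℕ → ℝ} {R x : ℝ}

theorem AbsConv.summable (h : AbsConv c R) (hx : |x| < R) : Summable fun k => c k * x ^ k := by
  have := h |x| (abs_nonneg x) hx
  refine Summable.of_norm (this.congr fun k => ?_)
  rw [Real.norm_eq_abs, abs_mul, abs_pow]

theorem AbsConv.hasSum (h : AbsConv c R) (hx : |x| < R) :
    HasSum (fun k => c k * x ^ k) (powSum c x) := (h.summable hx).hasSum

theorem AbsConv.derivCoeff (h : AbsConv c R) : AbsConv (derivCoeff c) R := by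
  intro r hr hrR
  obtain ⟨s, hrs, hsR⟩ := exists_between hrR
  have hs : 0 < s := hr.trans_lt hrs
  have hsum := (summable_nat_add_iff 1).2 (h s hs.le hsR)
  have hb : Tendsto (fun k : ℕ => (k : ℝ) * (r / s) ^ k + (r / s) ^ k) atTop (𝓝 (0 + 0)) := by
    have h1 : |r / s| < 1 := by
      rw [abs_of_nonneg (by positivity), div_lt_one hs]; exact hrs
    have h2 : r / s < 1 := (le_abs_self _).trans_lt h1
    exact (tendsto_self_mul_const_pow_of_abs_lt_one h1).add
      (tendsto_pow_atTop_nhds_zero_of_lt_one (by positivity) h2)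
  rw [add_zero] at hb
  obtain ⟨N, hN⟩ := eventually_atTop.1 (hb.eventually_le_const (show (0 : ℝ) < s by exact hs))
  refine Summable.of_norm_bounded_eventually_nat hsum ?_
  filter_upwards [eventually_ge_atTop N] with k hk
  have h3 := hN k hk
  have e : (k : ℝ) * (r / s) ^ k + (r / s) ^ k = ((k + 1) * r ^ k) / s ^ k := by
    rw [div_pow]; ring
  rw [e, div_le_iff₀ (by positivity)] at h3
  rw [Real.norm_eq_abs, abs_mul, abs_abs, abs_of_nonneg (by positivity : 0 ≤ r ^ k),
    RobinHemisphere.derivCoeff, abs_mul, abs_of_nonneg (by positivity : (0 : ℝ) ≤ (k : ℝ) + 1)]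
  calc ((k : ℝ) + 1) * |c (k + 1)| * r ^ k = |c (k + 1)| * ((k + 1) * r ^ k) := by ring
    _ ≤ |c (k + 1)| * (s * s ^ k) := by gcongr
    _ = |c (k + 1)| * s ^ (k + 1) := by ring

theorem AbsConv.hasDerivAt (h : AbsConv c R) (hx : |x| < R) :
    HasDerivAt (powSum c) (powSum (RobinHemisphere.derivCoeff c) x) x := by
  obtain ⟨s, hxs, hsR⟩ := exists_between hx
  have hs : 0 < s := (abs_nonneg x).trans_lt hxs
  have hd := h.derivCoeff
  have hsum : Summable fun k : ℕ => |c k| * (k * s ^ (k - 1)) := by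
    rw [← summable_nat_add_iff 1]
    refine (hd s hs.le hsR).congr fun k => ?_
    rw [RobinHemisphere.derivCoeff, abs_mul, abs_of_nonneg (by positivity : (0 : ℝ) ≤ (k : ℝ) + 1)]
    push_cast
    ring
  have := hasDerivAt_tsum_of_isPreconnected (g := fun k y => c k * y ^ k)
    (g' := fun k y => c k * (k * y ^ (k - 1))) (y₀ := 0) (y := x) (t := Set.Ioo (-s) s) hsum isOpen_Ioo
    isPreconnected_Ioo (fun k y _ => (hasDerivAt_pow k y).const_mul (c k))
    (fun k y hy => by
      rw [Real.norm_eq_abs, abs_mul, abs_mul, Nat.abs_cast, abs_pow]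
      have : |y| ≤ s := (abs_lt.2 hy).le
      gcongr)
    ⟨by linarith, hs⟩ (h.summable (by simpa using hs.trans hsR)) (abs_lt.1 hxs)
  have e : powSum (RobinHemisphere.derivCoeff c) x = ∑' k : ℕ, c k * (k * x ^ (k - 1)) := by
    have hshift : ∀ k : ℕ, RobinHemisphere.derivCoeff c k * x ^ k =
        c (k + 1) * (((k + 1 : ℕ) : ℝ) * x ^ (k + 1 - 1)) := fun k => by
      rw [RobinHemisphere.derivCoeff]; push_cast; ring
    have hsm : Summable fun k : ℕ => c k * (k * x ^ (k - 1)) := by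
      rw [← summable_nat_add_iff 1]
      exact (hd.summable hx).congr hshift
    rw [hsm.tsum_eq_zero_add, powSum, tsum_congr hshift]
    simp
  rw [e]
  exact this

theorem AbsConv.contDiffOn (n : ℕ) : ∀ {c : ℕ → ℝ}, AbsConv c R →
    ContDiffOn ℝ n (powSum c) (Set.Ioo (-R) R) := by
  induction n with
  | zero =>
    intro c h
    rw [Nat.cast_zero, contDiffOn_zero]
    exact fun y hy => (h.hasDerivAt (abs_lt.2 hy)).continuousAt.continuousWithinAt
  | succ n ih =>
    intro c h
    rw [show ((n + 1 : ℕ) : WithTop ℕ∞) = (n : WithTop ℕ∞) + 1 by push_cast; rfl,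
      contDiffOn_succ_iff_deriv_of_isOpen isOpen_Ioo]
    refine ⟨fun y hy => (h.hasDerivAt (abs_lt.2 hy)).differentiableAt.differentiableWithinAt,
      by simp, ?_⟩
    exact (ih h.derivCoeff).congr fun y hy => (h.hasDerivAt (abs_lt.2 hy)).deriv

theorem AbsConv.hasSum_mul_deriv (h : AbsConv c R) (hx : |x| < R) :
    HasSum (fun k : ℕ => k * c k * x ^ k) (x * powSum (RobinHemisphere.derivCoeff c) x) := by
  rw [← hasSum_nat_add_iff' 1]
  simp only [Finset.range_one, Finset.sum_singleton, Nat.cast_zero, zero_mul, sub_zero]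
  refine ((h.derivCoeff.hasSum hx).mul_left x).congr_fun ?_
  intro k
  rw [RobinHemisphere.derivCoeff]; push_cast; ring

theorem AbsConv.hasSum_sq_mul_deriv2 (h : AbsConv c R) (hx : |x| < R) :
    HasSum (fun k : ℕ => k * (k - 1) * c k * x ^ k)
      (x ^ 2 * powSum (RobinHemisphere.derivCoeff (RobinHemisphere.derivCoeff c)) x) := by
  rw [← hasSum_nat_add_iff' 1]
  simp only [Finset.range_one, Finset.sum_singleton, Nat.cast_zero, zero_mul, sub_zero]
  rw [sq, mul_assoc]
  refine ((h.derivCoeff.hasSum_mul_deriv hx).mul_left x).congr_fun ?_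
  intro k
  rw [RobinHemisphere.derivCoeff]; push_cast; ring

theorem summable_of_even_odd {a : ℕ → ℝ} (h0 : Summable fun k => a (2 * k))
    (h1 : Summable fun k => a (2 * k + 1)) : Summable a :=
  (h0.hasSum.even_add_odd h1.hasSum).summable

theorem absConv_of_two_step {q : ℕ → ℝ} {ρ : ℝ} (hc : ∀ k, c (k + 2) = q k * c k)
    (hq : Tendsto q atTop (𝓝 ρ)) (hρ : |ρ| * R ^ 2 = 1) : AbsConv c R := by
  intro r hr hrR
  have hlim : Tendsto (fun k => |q k| * r ^ 2) atTop (𝓝 (|ρ| * r ^ 2)) := hq.abs.mul_const _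
  have hlt : |ρ| * r ^ 2 < 1 := by
    rw [← hρ]
    have : 0 < |ρ| := by
      rcases (abs_nonneg ρ).eq_or_lt with h | h
      · rw [← h] at hρ; simp at hρ
      · exact h
    gcongr
  obtain ⟨s, hs1, hs2⟩ := exists_between hlt
  have hev : ∀ᶠ k in atTop, |q k| * r ^ 2 ≤ s := hlim.eventually_le_const hs1
  have step : ∀ k, |q k| * r ^ 2 ≤ s → ‖|c (k + 2)| * r ^ (k + 2)‖ ≤ s * ‖|c k| * r ^ k‖ := by
    intro k hk
    rw [Real.norm_of_nonneg (by positivity), Real.norm_of_nonneg (by positivity), hc, abs_mul]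
    calc |q k| * |c k| * r ^ (k + 2) = (|q k| * r ^ 2) * (|c k| * r ^ k) := by ring
      _ ≤ _ := by gcongr
  refine summable_of_even_odd ?_ ?_
  · refine summable_of_ratio_norm_eventually_le hs2 ?_
    have : Tendsto (fun k : ℕ => 2 * k) atTop atTop :=
      tendsto_atTop_mono (fun k => by simp only [id]; lia) tendsto_id
    filter_upwards [this.eventually hev] with k hk using step _ hk
  · refine summable_of_ratio_norm_eventually_le hs2 ?_
    have : Tendsto (fun k : ℕ => 2 * k + 1) atTop atTop :=
      tendsto_atTop_mono (fun k => by simp only [id]; lia) tendsto_id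
    filter_upwards [this.eventually hev] with k hk using step _ hk

/-- The coefficients of the Frobenius solution at the pole, in powers of `1 - z`. -/
noncomputable def frobCoeff (m : ℕ) (lam : ℝ) : ℕ → ℝ
  | 0 => 1
  | k + 1 => ((k + m) * (k + m + 1) - lam) / (2 * (k + 1) * (k + m + 1)) * frobCoeff m lam k

/-- The coefficients of the solution with Cauchy data `(a, b)` at the equator, in powers of `z`. -/
noncomputable def cauchyCoeff (m : ℕ) (lam a b : ℝ) : ℕ → ℝ
  | 0 => a
  | 1 => b
  | k + 2 => ((k + m) * (k + m + 1) - lam) / ((k + 1) * (k + 2)) * cauchyCoeff m lam a b k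

theorem tendsto_inv_nat_add (s : ℝ) : Tendsto (fun k : ℕ => ((k : ℝ) + s)⁻¹) atTop (𝓝 0) :=
  (tendsto_atTop_add_const_right _ _ tendsto_natCast_atTop_atTop).inv_tendsto_atTop

theorem tendsto_add_div_add (s t : ℝ) :
    Tendsto (fun k : ℕ => ((k : ℝ) + s) / (k + t)) atTop (𝓝 1) := by
  have h : Tendsto (fun k : ℕ => 1 + (s - t) * ((k : ℝ) + t)⁻¹) atTop (𝓝 (1 + (s - t) * 0)) :=
    tendsto_const_nhds.add ((tendsto_inv_nat_add t).const_mul _)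
  rw [mul_zero, add_zero] at h
  refine h.congr' ?_
  filter_upwards [eventually_gt_atTop ⌈|t|⌉₊] with k hk
  have h1 : |t| < k := (Nat.le_ceil _).trans_lt (by exact_mod_cast hk)
  have h2 : (k : ℝ) + t ≠ 0 := by linarith [neg_abs_le t]
  field_simp
  ring

theorem tendsto_recurrence_ratio (m : ℕ) (lam s t : ℝ) :
    Tendsto (fun k : ℕ => (((k : ℝ) + m) * (k + m + 1) - lam) / ((k + s) * (k + t))) atTop
      (𝓝 1) := by
  have h := ((tendsto_add_div_add m s).mul (tendsto_add_div_add (m + 1) t)).sub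
    (((tendsto_inv_nat_add s).mul (tendsto_inv_nat_add t)).const_mul lam)
  simp only [mul_one, mul_zero, sub_zero] at h
  refine h.congr fun k => ?_
  rw [div_mul_div_comm, ← mul_inv, sub_div, div_eq_mul_inv lam, add_assoc]

theorem absConv_frobCoeff (m : ℕ) (lam : ℝ) : AbsConv (frobCoeff m lam) 2 := by
  set p : ℕ → ℝ := fun k => ((k + m) * (k + m + 1) - lam) / (2 * (k + 1) * (k + m + 1)) with hp
  have hlim : Tendsto p atTop (𝓝 (1 / 2)) := by
    have h := (tendsto_recurrence_ratio m lam 1 (m + 1)).const_mul (1 / 2)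
    rw [mul_one] at h
    refine h.congr fun k => ?_
    rw [hp, one_div_mul_eq_div, div_div]; congr 1; ring
  refine absConv_of_two_step (q := fun k => p (k + 1) * p k) (ρ := 1 / 2 * (1 / 2))
    (fun k => ?_) (((tendsto_add_atTop_iff_nat 1).2 hlim).mul hlim) (by norm_num)
  rw [frobCoeff, frobCoeff, ← mul_assoc]

theorem absConv_cauchyCoeff (m : ℕ) (lam a b : ℝ) : AbsConv (cauchyCoeff m lam a b) 1 :=
  absConv_of_two_step (fun k => by rw [cauchyCoeff])
    (tendsto_recurrence_ratio m lam 1 2) (by norm_num)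

/-- The Frobenius solution at the pole, as a function of `1 - z`. -/
noncomputable def frob (m : ℕ) (lam : ℝ) : ℝ → ℝ := powSum (frobCoeff m lam)

/-- The derivative of `frob`. -/
noncomputable def frob' (m : ℕ) (lam : ℝ) : ℝ → ℝ := powSum (derivCoeff (frobCoeff m lam))

/-- The second derivative of `frob`. -/
noncomputable def frob'' (m : ℕ) (lam : ℝ) : ℝ → ℝ :=
  powSum (derivCoeff (derivCoeff (frobCoeff m lam)))

theorem hasDerivAt_frob (m : ℕ) (lam : ℝ) (hx : |x| < 2) :
    HasDerivAt (frob m lam) (frob' m lam x) x := (absConv_frobCoeff m lam).hasDerivAt hx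

theorem hasDerivAt_frob' (m : ℕ) (lam : ℝ) (hx : |x| < 2) :
    HasDerivAt (frob' m lam) (frob'' m lam x) x :=
  (absConv_frobCoeff m lam).derivCoeff.hasDerivAt hx

theorem powSum_zero (c : ℕ → ℝ) : powSum c 0 = c 0 := by
  rw [powSum, tsum_eq_single 0]
  · simp
  · intro k hk; simp [hk]

theorem frob_zero (m : ℕ) (lam : ℝ) : frob m lam 0 = 1 := by rw [frob, powSum_zero, frobCoeff]

theorem frob_ode (m : ℕ) (lam : ℝ) (hx : |x| < 2) :
    x * (2 - x) * frob'' m lam x + 2 * (m + 1) * (1 - x) * frob' m lam x +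
      (lam - m * (m + 1)) * frob m lam x = 0 := by
  have h := absConv_frobCoeff m lam
  have h0 := h.hasSum hx
  have h1 := h.derivCoeff.hasSum hx
  have h2 := h.hasSum_mul_deriv hx
  have h3 := h.derivCoeff.hasSum_mul_deriv hx
  have h4 := h.hasSum_sq_mul_deriv2 hx
  have hs := ((((h3.mul_left 2).sub h4).add (h1.mul_left (2 * ((m : ℝ) + 1)))).sub
    (h2.mul_left (2 * ((m : ℝ) + 1)))).add (h0.mul_left (lam - m * (m + 1)))
  have hs' := hs.congr_fun (g := fun _ => 0) fun k => ?_
  · have := hs'.unique hasSum_zero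
    change _ + 2 * ((m : ℝ) + 1) * frob' m lam x - 2 * (m + 1) * (x * frob' m lam x) +
      (lam - m * (m + 1)) * frob m lam x = 0 at this
    change 2 * (x * frob'' m lam x) - x ^ 2 * frob'' m lam x + _ - _ + _ = 0 at this
    linear_combination this
  · simp only [derivCoeff, frobCoeff]
    have e1 : (k : ℝ) + 1 ≠ 0 := by positivity
    have e2 : (k : ℝ) + m + 1 ≠ 0 := by positivity
    field_simp
    ring

theorem cauchy_ode (m : ℕ) (lam a b : ℝ) (hx : |x| < 1) :
    (1 - x ^ 2) * powSum (derivCoeff (derivCoeff (cauchyCoeff m lam a b))) x -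
      2 * (m + 1) * x * powSum (derivCoeff (cauchyCoeff m lam a b)) x +
      (lam - m * (m + 1)) * powSum (cauchyCoeff m lam a b) x = 0 := by
  have h := absConv_cauchyCoeff m lam a b
  have h0 := h.hasSum hx
  have h2 := h.hasSum_mul_deriv hx
  have h3 := h.derivCoeff.derivCoeff.hasSum hx
  have h4 := h.hasSum_sq_mul_deriv2 hx
  have hs := ((h3.sub h4).sub (h2.mul_left (2 * ((m : ℝ) + 1)))).add
    (h0.mul_left (lam - m * (m + 1)))
  have hs' := hs.congr_fun (g := fun _ => 0) fun k => ?_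
  · have := hs'.unique hasSum_zero
    linear_combination this
  · simp only [derivCoeff, cauchyCoeff]
    push_cast
    have e1 : (k : ℝ) + 1 ≠ 0 := by positivity
    have e2 : (k : ℝ) + 2 ≠ 0 := by positivity
    have e3 : (k : ℝ) + 1 + 1 ≠ 0 := by positivity
    field_simp
    ring

theorem frobCoeff_nonneg {m : ℕ} {lam : ℝ} (h : lam ≤ m * (m + 1)) (k : ℕ) :
    0 ≤ frobCoeff m lam k := by
  induction k with
  | zero => simp [frobCoeff]
  | succ k ih =>
    rw [frobCoeff]
    have h1 : (0 : ℝ) ≤ k * k + k * (2 * m + 1) := by positivity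
    have : (0 : ℝ) ≤ (k + m) * (k + m + 1) - lam := by nlinarith
    positivity

theorem one_le_frob_one {m : ℕ} {lam : ℝ} (h : lam ≤ m * (m + 1)) : 1 ≤ frob m lam 1 := by
  have hs := (absConv_frobCoeff m lam).hasSum (x := 1) (by norm_num)
  have := le_hasSum hs 0 fun k _ => by have := frobCoeff_nonneg h k; simpa using this
  simpa [frobCoeff, frob] using this

theorem frobCoeff_one_le_frob' {m : ℕ} {lam : ℝ} (h : lam ≤ m * (m + 1)) :
    (m * (m + 1) - lam) / (2 * (m + 1)) ≤ frob' m lam 1 := by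
  have hs := (absConv_frobCoeff m lam).derivCoeff.hasSum (x := 1) (by norm_num)
  have := le_hasSum hs 0 fun k _ => by
    have := frobCoeff_nonneg h (k + 1)
    simp only [derivCoeff, one_pow, mul_one]
    positivity
  simpa [frobCoeff, derivCoeff, frob'] using this

theorem frob'_eq_zero (m : ℕ) : frob' m (m * (m + 1)) x = 0 := by
  have h : ∀ k, frobCoeff m (m * (m + 1)) (k + 1) = 0 := by
    intro k
    induction k with
    | zero => simp [frobCoeff]
    | succ k ih => rw [frobCoeff, ih, mul_zero]
  simp [frob', powSum, derivCoeff, h]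

end PowerSeries

theorem eq_zero_of_second_order_ode {E : Type*} [NormedAddCommGroup E] [NormedSpace ℝ E]
    {y y' : ℝ → E} {p q : ℝ → ℝ} {a b K : ℝ}
    (hy : ContinuousOn y (Set.Icc a b)) (hy' : ContinuousOn y' (Set.Icc a b))
    (hd : ∀ t ∈ Set.Ico a b, HasDerivWithinAt y (y' t) (Set.Ici t) t)
    (hd' : ∀ t ∈ Set.Ico a b, HasDerivWithinAt y' (p t • y' t + q t • y t) (Set.Ici t) t)
    (hp : ∀ t ∈ Set.Ico a b, |p t| ≤ K) (hq : ∀ t ∈ Set.Ico a b, |q t| ≤ K)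
    (h0 : y a = 0) (h0' : y' a = 0) {t : ℝ} (ht : t ∈ Set.Icc a b) : y t = 0 := by
  have key := ODE_solution_unique_of_mem_Icc_right
    (v := fun t (u : E × E) => (u.2, p t • u.2 + q t • u.1)) (s := fun _ => Set.univ)
    (K := Real.toNNReal (1 + 2 * |K|)) (f := fun t => (y t, y' t)) (g := fun _ => (0, 0))
    (a := a) (b := b) (fun t ht => ?_) (hy.prodMk hy')
    (fun t ht => (hd t ht).prodMk (hd' t ht)) (fun _ _ => Set.mem_univ _)
    continuousOn_const (fun t _ => by
      simp only [smul_zero, add_zero]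
      exact hasDerivWithinAt_const t (Set.Ici t) ((0 : E), (0 : E)))
    (fun _ _ => Set.mem_univ _) (by simp [h0, h0'])
  · exact congrArg Prod.fst (key ht)
  · refine LipschitzWith.lipschitzOnWith (LipschitzWith.of_dist_le_mul fun u w => ?_)
    have hp' := (hp t ht).trans (le_abs_self K)
    have hq' := (hq t ht).trans (le_abs_self K)
    rw [Real.coe_toNNReal _ (by positivity), dist_eq_norm, dist_eq_norm]
    have h1 : ‖u.1 - w.1‖ ≤ ‖u - w‖ := norm_fst_le (u - w)
    have h2 : ‖u.2 - w.2‖ ≤ ‖u - w‖ := norm_snd_le (u - w)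
    have h3 : 0 ≤ |K| := abs_nonneg K
    have h4 := norm_nonneg (u - w)
    refine max_le ?_ ?_
    · change ‖u.2 - w.2‖ ≤ _
      nlinarith
    · change ‖(p t • u.2 + q t • u.1) - (p t • w.2 + q t • w.1)‖ ≤ _
      have e : (p t • u.2 + q t • u.1) - (p t • w.2 + q t • w.1) =
          p t • (u.2 - w.2) + q t • (u.1 - w.1) := by
        rw [smul_sub, smul_sub]; abel
      rw [e]
      calc _ ≤ ‖p t • (u.2 - w.2)‖ + ‖q t • (u.1 - w.1)‖ := norm_add_le _ _
        _ = |p t| * ‖u.2 - w.2‖ + |q t| * ‖u.1 - w.1‖ := by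
          rw [norm_smul, norm_smul, Real.norm_eq_abs, Real.norm_eq_abs]
        _ ≤ |K| * ‖u - w‖ + |K| * ‖u - w‖ := by gcongr
        _ ≤ _ := by nlinarith

theorem sum_limits_nonpos_of_bounded {a b : ℕ → ℝ} {A B M : ℝ} (m : ℕ)
    (ha : Tendsto (fun n : ℕ => n * a (n + 1) / n ^ m) atTop (𝓝 A))
    (hb : Tendsto (fun n : ℕ => n * b (n + 1) / n ^ m) atTop (𝓝 B))
    (hs : ∀ z : ℝ, 0 ≤ z → z < 1 → Summable fun n => (a n + b n * z) * z ^ (2 * n))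
    (hM : ∀ z : ℝ, 0 ≤ z → z < 1 → ∑' n, (a n + b n * z) * z ^ (2 * n) ≤ M) : A + B ≤ 0 := by
  by_contra! hS
  set S := A + B
  have hev : ∀ᶠ n : ℕ in atTop, S / 2 ≤ n * a (n + 1) / n ^ m + n * b (n + 1) / n ^ m :=
    (ha.add hb).eventually_const_le (by linarith)
  have hevb : ∀ᶠ n : ℕ in atTop, |n * b (n + 1) / n ^ m| ≤ |B| + 1 :=
    hb.abs.eventually_le_const (by linarith)
  obtain ⟨N, hN⟩ := eventually_atTop.1 ((hev.and hevb).and (eventually_ge_atTop 1))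
  have hD : 0 < |B| + 1 := by positivity
  set z₀ := max 0 (1 - S / (4 * (|B| + 1))) with hz₀
  have hz₀1 : z₀ < 1 := max_lt one_pos (by have : 0 < S / (4 * (|B| + 1)) := by positivity
                                           linarith)
  have term : ∀ n ≥ N, ∀ z, z₀ ≤ z → z ≤ 1 →
      S / 4 * (1 / n) ≤ a (n + 1) + b (n + 1) * z := by
    intro n hn z hz hz1
    obtain ⟨⟨h1, h2⟩, h3⟩ := hN n hn
    have hn0 : (1 : ℝ) ≤ n := by exact_mod_cast h3
    have h4 : (1 - z) * (|B| + 1) ≤ S / 4 := by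
      have : 1 - z ≤ S / (4 * (|B| + 1)) := by linarith [(le_max_right _ _).trans hz]
      calc (1 - z) * (|B| + 1) ≤ S / (4 * (|B| + 1)) * (|B| + 1) := by gcongr
        _ = S / 4 := by field_simp
    have h5 : (1 - z) * (n * b (n + 1) / n ^ m) ≤ S / 4 := by
      refine le_trans ?_ h4
      exact mul_le_mul_of_nonneg_left ((le_abs_self _).trans h2) (by linarith)
    have hnm : (1 : ℝ) ≤ (n : ℝ) ^ m := one_le_pow₀ hn0
    have h6 : S / 4 ≤ n * (a (n + 1) + b (n + 1) * z) / n ^ m := by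
      have e : n * (a (n + 1) + b (n + 1) * z) / n ^ m = n * a (n + 1) / n ^ m +
        n * b (n + 1) / n ^ m - (1 - z) * (n * b (n + 1) / n ^ m) := by ring
      linarith
    rw [le_div_iff₀ (by positivity)] at h6
    have h7 : S / 4 ≤ n * (a (n + 1) + b (n + 1) * z) := by nlinarith
    rw [mul_one_div, div_le_iff₀ (by positivity)]
    linarith
  have part : ∀ K : ℕ, ∑ n ∈ Finset.range (N + 1 + K), (a n + b n) ≤ M := by
    intro K
    have hcont : Tendsto (fun z : ℝ => ∑ n ∈ Finset.range (N + 1 + K), (a n + b n * z) * z ^ (2 * n))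
        (𝓝[<] 1) (𝓝 (∑ n ∈ Finset.range (N + 1 + K), (a n + b n))) := by
      have : Continuous (fun z : ℝ =>
        ∑ n ∈ Finset.range (N + 1 + K), (a n + b n * z) * z ^ (2 * n)) := by fun_prop
      have h := (this.tendsto 1).mono_left (nhdsWithin_le_nhds (s := Set.Iio 1))
      simpa using h
    refine le_of_tendsto hcont ?_
    filter_upwards [Ioo_mem_nhdsLT hz₀1] with z hz
    have hz0 : 0 ≤ z := (le_max_left _ _).trans hz.1.le
    refine le_trans ?_ (hM z hz0 hz.2)
    refine (hs z hz0 hz.2).sum_le_tsum _ fun n hn => ?_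
    have hn' : N + 1 ≤ n := by
      have := Finset.mem_range.not.1 hn
      omega
    obtain ⟨k, rfl⟩ : ∃ k, n = k + 1 := ⟨n - 1, by omega⟩
    have := term k (by omega) z hz.1.le hz.2.le
    have h8 : 0 ≤ S / 4 * (1 / (k : ℝ)) := by positivity
    exact mul_nonneg (h8.trans this) (by positivity)
  have hsum : Summable fun n : ℕ => S / 4 * (1 / ((n + N : ℕ) : ℝ)) := by
    refine summable_of_sum_range_le (c := M - ∑ n ∈ Finset.range (N + 1), (a n + b n))
      (fun n => by positivity) fun K => ?_
    have h := part K
    rw [Finset.sum_range_add] at h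
    have : ∑ n ∈ Finset.range K, S / 4 * (1 / ((n + N : ℕ) : ℝ)) ≤
        ∑ n ∈ Finset.range K, (a (N + 1 + n) + b (N + 1 + n)) := by
      refine Finset.sum_le_sum fun n _ => ?_
      have := term (n + N) (by omega) 1 hz₀1.le le_rfl
      rw [mul_one] at this
      rwa [show N + 1 + n = n + N + 1 by omega]
    linarith
  have h9 := (summable_mul_left_iff (show S / 4 ≠ 0 by positivity)).1 hsum
  exact Real.not_summable_one_div_natCast ((summable_nat_add_iff N).1 h9)

theorem sum_limits_eq_zero_of_bounded {a b : ℕ → ℝ} {A B M : ℝ} (m : ℕ)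
    (ha : Tendsto (fun n : ℕ => n * a (n + 1) / n ^ m) atTop (𝓝 A))
    (hb : Tendsto (fun n : ℕ => n * b (n + 1) / n ^ m) atTop (𝓝 B))
    (hs : ∀ z : ℝ, 0 ≤ z → z < 1 → Summable fun n => (a n + b n * z) * z ^ (2 * n))
    (hM : ∀ z : ℝ, 0 ≤ z → z < 1 → |∑' n, (a n + b n * z) * z ^ (2 * n)| ≤ M) : A + B = 0 := by
  refine le_antisymm (sum_limits_nonpos_of_bounded m ha hb hs
    fun z h0 h1 => (le_abs_self _).trans (hM z h0 h1)) ?_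
  have e : ∀ z : ℝ, (fun n => ((-a) n + (-b) n * z) * z ^ (2 * n)) =
      fun n => -((a n + b n * z) * z ^ (2 * n)) := fun z => by
    funext n; simp only [Pi.neg_apply]; ring
  have := sum_limits_nonpos_of_bounded (a := -a) (b := -b) (A := -A) (B := -B) (M := M) m
    (by simpa [mul_neg, neg_div] using ha.neg) (by simpa [mul_neg, neg_div] using hb.neg)
    (fun z h0 h1 => by rw [e]; exact (hs z h0 h1).neg)
    (fun z h0 h1 => by rw [e, tsum_neg]; exact (neg_le_abs _).trans (hM z h0 h1))
  linarith

/-- The rising factorial `s (s + 1) ⋯ (s + n)`, normalized so that it tends to `1 / Γ(s)`. -/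
noncomputable def risingSeq (s : ℝ) (n : ℕ) : ℝ :=
  (∏ j ∈ Finset.range (n + 1), (s + j)) / (n ^ s * n.factorial)

theorem tendsto_risingSeq (s : ℝ) :
    Tendsto (risingSeq s) atTop (𝓝 (Real.Gamma s)⁻¹) := by
  by_cases h : ∃ k : ℕ, s = -k
  · obtain ⟨k, rfl⟩ := h
    rw [Real.Gamma_neg_nat_eq_zero, inv_zero]
    refine tendsto_const_nhds.congr' ?_
    filter_upwards [eventually_ge_atTop k] with n hn
    rw [risingSeq, Finset.prod_eq_zero (Finset.mem_range.2 (Nat.lt_succ_of_le hn)) (by simp),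
      zero_div]
  · push Not at h
    have := (Real.GammaSeq_tendsto_Gamma s).inv₀ (Real.Gamma_ne_zero h)
    refine this.congr fun n => ?_
    rw [risingSeq, Real.GammaSeq, inv_div]

theorem prod_eq_risingSeq (s : ℝ) {n : ℕ} (hn : 0 < n) :
    ∏ j ∈ Finset.range (n + 1), (s + j) = risingSeq s n * (n ^ s * n.factorial) := by
  have : (0 : ℝ) < n := by exact_mod_cast hn
  rw [risingSeq]
  field_simp

theorem tendsto_hypergeometric_coeff {a : ℕ → ℝ} {p q r s : ℝ} {m : ℕ} (hr : 0 < r) (hs : 0 < s)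
    (hrec : ∀ n : ℕ, a (n + 1) = (p + n) * (q + n) / ((r + n) * (s + n)) * a n)
    (hpq : p + q = r + s - 1 + m) :
    Tendsto (fun n : ℕ => n * a (n + 1) / n ^ m) atTop
      (𝓝 (a 0 * ((Real.Gamma p)⁻¹ * (Real.Gamma q)⁻¹ * (Real.Gamma r * Real.Gamma s)))) := by
  have hprod : ∀ n, a n = a 0 * ((∏ j ∈ Finset.range n, (p + j)) * (∏ j ∈ Finset.range n, (q + j)) /
      ((∏ j ∈ Finset.range n, (r + j)) * (∏ j ∈ Finset.range n, (s + j)))) := by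
    intro n
    induction n with
    | zero => simp
    | succ n ih =>
      rw [hrec, ih]
      simp only [Finset.prod_range_succ]
      rw [mul_comm _ (a 0 * _), mul_assoc, div_mul_div_comm]
      congr 2 <;> ring
  have h := (((tendsto_risingSeq p).mul (tendsto_risingSeq q)).mul
    (((tendsto_risingSeq r).inv₀ (inv_ne_zero (Real.Gamma_pos_of_pos hr).ne')).mul
      ((tendsto_risingSeq s).inv₀ (inv_ne_zero (Real.Gamma_pos_of_pos hs).ne')))).const_mul (a 0)
  simp only [inv_inv] at h
  refine h.congr' ?_
  filter_upwards [eventually_gt_atTop 0] with n hn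
  have hn' : (0 : ℝ) < n := by exact_mod_cast hn
  rw [hprod (n + 1), prod_eq_risingSeq p hn, prod_eq_risingSeq q hn, prod_eq_risingSeq r hn,
    prod_eq_risingSeq s hn]
  have hpow : (n : ℝ) * ((n : ℝ) ^ p * (n : ℝ) ^ q) = (n : ℝ) ^ r * (n : ℝ) ^ s * (n : ℝ) ^ m := by
    rw [← Real.rpow_add hn', ← Real.rpow_add hn', hpq, ← Real.rpow_natCast,
      ← Real.rpow_add hn', mul_comm, ← Real.rpow_add_one hn'.ne']
    congr 1; ring
  have hf : (n.factorial : ℝ) ≠ 0 := by positivity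
  have h1 : (n : ℝ) ^ r ≠ 0 := by positivity
  have h2 : (n : ℝ) ^ s ≠ 0 := by positivity
  have h3 : (n : ℝ) ^ m ≠ 0 := by positivity
  have e : (n : ℝ) * (a 0 * (risingSeq p n * ((n : ℝ) ^ p * n.factorial) *
      (risingSeq q n * ((n : ℝ) ^ q * n.factorial)) /
      (risingSeq r n * ((n : ℝ) ^ r * n.factorial) *
      (risingSeq s n * ((n : ℝ) ^ s * n.factorial))))) / (n : ℝ) ^ m =
      a 0 * (risingSeq p n * risingSeq q n * ((risingSeq r n)⁻¹ * (risingSeq s n)⁻¹)) *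
      (((n : ℝ) * ((n : ℝ) ^ p * (n : ℝ) ^ q)) / ((n : ℝ) ^ r * (n : ℝ) ^ s * (n : ℝ) ^ m)) := by
    field_simp
  rw [e, hpow, div_self (by positivity), mul_one]

theorem hasDerivAt_frob_one_sub (m : ℕ) (lam : ℝ) {z : ℝ} (h : |1 - z| < 2) :
    HasDerivAt (fun z => frob m lam (1 - z)) (-frob' m lam (1 - z)) z := by
  simpa using (hasDerivAt_frob m lam h).comp_const_sub 1 z

theorem hasDerivAt_frob'_one_sub (m : ℕ) (lam : ℝ) {z : ℝ} (h : |1 - z| < 2) :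
    HasDerivAt (fun z => -frob' m lam (1 - z)) (frob'' m lam (1 - z)) z := by
  have := ((hasDerivAt_frob' m lam h).comp_const_sub 1 z).neg
  rwa [neg_neg] at this

theorem legendre_eq_zero {m : ℕ} {lam : ℝ} {y y' y'' : ℝ → ℝ}
    (hy : ∀ z, 0 ≤ z → z < 1 → HasDerivAt y (y' z) z)
    (hy' : ∀ z, 0 ≤ z → z < 1 → HasDerivAt y' (y'' z) z)
    (hode : ∀ z, 0 ≤ z → z < 1 →
      (1 - z ^ 2) * y'' z - 2 * (m + 1) * z * y' z + (lam - m * (m + 1)) * y z = 0)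
    (h0 : y 0 = 0) (h0' : y' 0 = 0) {z : ℝ} (hz : 0 ≤ z) (hz1 : z < 1) : y z = 0 := by
  have hd : 0 < 1 - z ^ 2 := by nlinarith
  have hle : ∀ t ∈ Set.Ico 0 z, 1 - z ^ 2 ≤ 1 - t ^ 2 := fun t ht => by nlinarith [ht.1, ht.2]
  refine eq_zero_of_second_order_ode (y' := y') (a := 0) (b := z)
    (p := fun t => 2 * (m + 1) * t / (1 - t ^ 2))
    (q := fun t => -(lam - m * (m + 1)) / (1 - t ^ 2))
    (K := (2 * (m + 1) + |lam - m * (m + 1)|) / (1 - z ^ 2))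
    (fun t ht => (hy t ht.1 (ht.2.trans_lt hz1)).continuousAt.continuousWithinAt)
    (fun t ht => (hy' t ht.1 (ht.2.trans_lt hz1)).continuousAt.continuousWithinAt)
    (fun t ht => (hy t ht.1 (ht.2.trans hz1)).hasDerivWithinAt)
    (fun t ht => ?_) (fun t ht => ?_) (fun t ht => ?_) h0 h0' ⟨hz, le_rfl⟩
  · have h1 := hy' t ht.1 (ht.2.trans hz1)
    have h2 := hode t ht.1 (ht.2.trans hz1)
    have h3 : 1 - t ^ 2 ≠ 0 := (hd.trans_le (hle t ht)).ne'
    convert h1.hasDerivWithinAt using 1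
    simp only [smul_eq_mul]
    field_simp
    linear_combination -h2
  · have h3 := hd.trans_le (hle t ht)
    rw [abs_div, abs_of_pos h3]
    have : |2 * ((m : ℝ) + 1) * t| ≤ 2 * (m + 1) + |lam - m * (m + 1)| := by
      rw [abs_of_nonneg (by have := ht.1; positivity)]
      have : 2 * ((m : ℝ) + 1) * t ≤ 2 * (m + 1) * 1 := by
        apply mul_le_mul_of_nonneg_left _ (by positivity)
        linarith [ht.2]
      linarith [abs_nonneg (lam - m * (m + 1))]
    exact div_le_div₀ (by positivity) this hd (hle t ht)
  · have h3 := hd.trans_le (hle t ht)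
    rw [abs_div, abs_of_pos h3, abs_neg]
    exact div_le_div₀ (by positivity)
      (le_add_of_nonneg_left (by positivity)) hd (hle t ht)

theorem abs_one_sub_lt_two {z : ℝ} (h0 : 0 ≤ z) (h1 : z ≤ 1) : |1 - z| < 2 := by
  rw [abs_lt]; constructor <;> linarith

theorem frob_one_ne_zero_or (m : ℕ) (lam : ℝ) : frob m lam 1 ≠ 0 ∨ frob' m lam 1 ≠ 0 := by
  by_contra! h
  have hz : ∀ z : ℝ, 0 ≤ z → z < 1 → frob m lam (1 - z) = 0 := fun z h0 h1 =>
    legendre_eq_zero (m := m) (lam := lam) (y := fun z => frob m lam (1 - z))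
      (fun z h0 h1 => hasDerivAt_frob_one_sub m lam (abs_one_sub_lt_two h0 h1.le))
      (fun z h0 h1 => hasDerivAt_frob'_one_sub m lam (abs_one_sub_lt_two h0 h1.le))
      (fun z h0 h1 => by
        linear_combination frob_ode m lam (abs_one_sub_lt_two h0 h1.le))
      (by simpa using h.1) (by simpa using h.2) h0 h1
  have hc : Tendsto (fun z => frob m lam (1 - z)) (𝓝[<] 1) (𝓝 (frob m lam (1 - 1))) :=
    (hasDerivAt_frob_one_sub m lam (abs_one_sub_lt_two zero_le_one le_rfl)).continuousAt.tendsto.mono_left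
      nhdsWithin_le_nhds
  rw [sub_self, frob_zero] at hc
  have h2 : Tendsto (fun z => frob m lam (1 - z)) (𝓝[<] 1) (𝓝 0) := by
    refine tendsto_const_nhds.congr' ?_
    filter_upwards [Ioo_mem_nhdsLT zero_lt_one] with z hzz
    exact (hz z hzz.1.le hzz.2).symm
  exact one_ne_zero (tendsto_nhds_unique hc h2)

theorem powSum_cauchyCoeff_eq_frob (m : ℕ) (lam : ℝ) {z : ℝ} (h0 : 0 ≤ z) (h1 : z < 1) :
    powSum (cauchyCoeff m lam (frob m lam 1) (-frob' m lam 1)) z = frob m lam (1 - z) := by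
  set c := cauchyCoeff m lam (frob m lam 1) (-frob' m lam 1) with hc
  have hC : AbsConv c 1 := absConv_cauchyCoeff m lam _ _
  have habs : ∀ z : ℝ, 0 ≤ z → z < 1 → |z| < 1 := fun z h0 h1 => by rwa [abs_of_nonneg h0]
  refine sub_eq_zero.1 (legendre_eq_zero (m := m) (lam := lam)
    (y := fun z => powSum c z - frob m lam (1 - z))
    (fun z h0 h1 => (hC.hasDerivAt (habs z h0 h1)).sub
      (hasDerivAt_frob_one_sub m lam (abs_one_sub_lt_two h0 h1.le)))
    (fun z h0 h1 => (hC.derivCoeff.hasDerivAt (habs z h0 h1)).sub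
      (hasDerivAt_frob'_one_sub m lam (abs_one_sub_lt_two h0 h1.le)))
    (fun z h0 h1 => ?_) ?_ ?_ h0 h1)
  · have e1 := frob_ode m lam (abs_one_sub_lt_two h0 h1.le)
    have e2 := cauchy_ode m lam (frob m lam 1) (-frob' m lam 1) (habs z h0 h1)
    linear_combination e2 - e1
  · simp [powSum_zero, hc, cauchyCoeff]
  · simp [powSum_zero, hc, cauchyCoeff, derivCoeff]

theorem inv_Gamma_eq {p : ℝ} (hp : p < 1) :
    (Real.Gamma p)⁻¹ = Real.Gamma (1 - p) * Real.sin (Real.pi * p) / Real.pi := by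
  have h := congrArg (·⁻¹) (Real.Gamma_mul_Gamma_one_sub p)
  simp only [mul_inv, inv_div] at h
  have h0 := (Real.Gamma_pos_of_pos (show 0 < 1 - p by linarith)).ne'
  rw [mul_div_assoc, ← h]
  field_simp

theorem hasSum_even_odd {c : ℕ → ℝ} (hC : AbsConv c 1) {z : ℝ} (h0 : 0 ≤ z) (h1 : z < 1) :
    HasSum (fun n => (c (2 * n) + c (2 * n + 1) * z) * z ^ (2 * n)) (powSum c z) := by
  have h : HasSum (fun k => c k * z ^ k) (powSum c z) := hC.hasSum (by rwa [abs_of_nonneg h0])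
  have he : Summable fun n => c (2 * n) * z ^ (2 * n) :=
    h.summable.comp_injective (i := fun n => 2 * n) fun a b hab => by simpa using hab
  have ho : Summable fun n => c (2 * n + 1) * z ^ (2 * n + 1) :=
    h.summable.comp_injective (i := fun n => 2 * n + 1) fun a b hab => by simpa using hab
  have h2 := he.hasSum.even_add_odd (f := fun k => c k * z ^ k) ho.hasSum
  rw [← h2.unique h]
  refine (he.hasSum.add ho.hasSum).congr_fun fun n => ?_
  ring

theorem coeff_relation_of_bounded {c : ℕ → ℝ} {m : ℕ} {ν M : ℝ} (hC : AbsConv c 1)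
    (hrec : ∀ k : ℕ, c (k + 2) =
      ((k + m) * (k + m + 1) - ν * (ν + 1)) / ((k + 1) * (k + 2)) * c k)
    (hM : ∀ z : ℝ, 0 ≤ z → z < 1 → |powSum c z| ≤ M) :
    c 0 * ((Real.Gamma ((m - ν) / 2))⁻¹ * (Real.Gamma ((ν + m + 1) / 2))⁻¹ *
        Real.Gamma (1 / 2)) +
      c 1 * ((Real.Gamma ((m - ν) / 2 + 1 / 2))⁻¹ *
        (Real.Gamma ((ν + m + 1) / 2 + 1 / 2))⁻¹ * Real.Gamma (3 / 2)) = 0 := by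
  have hA := tendsto_hypergeometric_coeff (a := fun n => c (2 * n)) (m := m)
      (p := (m - ν) / 2) (q := (ν + m + 1) / 2) (r := 1 / 2) (s := 1)
      (by norm_num) one_pos (fun n => by
        rw [show 2 * (n + 1) = 2 * n + 2 by ring, hrec]
        congr 1
        push_cast
        rw [div_eq_div_iff (by positivity) (by positivity)]
        ring) (by ring)
  have hB := tendsto_hypergeometric_coeff (a := fun n => c (2 * n + 1)) (m := m)
      (p := (m - ν) / 2 + 1 / 2) (q := (ν + m + 1) / 2 + 1 / 2) (r := 1)
      (s := 3 / 2) one_pos (by norm_num) (fun n => by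
        rw [show 2 * (n + 1) + 1 = 2 * n + 1 + 2 by ring, hrec]
        congr 1
        push_cast
        rw [div_eq_div_iff (by positivity) (by positivity)]
        ring) (by ring)
  have key := sum_limits_eq_zero_of_bounded (M := M) m hA hB
    (fun z h0 h1 => (hasSum_even_odd hC h0 h1).summable)
    (fun z h0 h1 => by rw [(hasSum_even_odd hC h0 h1).tsum_eq]; exact hM z h0 h1)
  rw [Real.Gamma_one, mul_one, one_mul] at key
  exact key

theorem connection_Gamma {m : ℕ} {ν : ℝ} :
    frob m (ν * (ν + 1)) 1 * ((Real.Gamma ((m - ν) / 2))⁻¹ * (Real.Gamma ((ν + m + 1) / 2))⁻¹ *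
        Real.Gamma (1 / 2)) +
      -frob' m (ν * (ν + 1)) 1 * ((Real.Gamma ((m - ν) / 2 + 1 / 2))⁻¹ *
        (Real.Gamma ((ν + m + 1) / 2 + 1 / 2))⁻¹ * Real.Gamma (3 / 2)) = 0 := by
  have hcont : ContinuousOn (fun z => frob m (ν * (ν + 1)) (1 - z)) (Set.Icc 0 1) := fun z hz =>
    (hasDerivAt_frob_one_sub m _ (abs_one_sub_lt_two hz.1 hz.2)).continuousAt.continuousWithinAt
  obtain ⟨M, hM⟩ := isCompact_Icc.exists_bound_of_continuousOn hcont
  have h := coeff_relation_of_bounded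
    (absConv_cauchyCoeff m (ν * (ν + 1)) (frob m (ν * (ν + 1)) 1) (-frob' m (ν * (ν + 1)) 1))
    (fun k => by rw [cauchyCoeff]) (M := M) (fun z h0 h1 => by
      rw [powSum_cauchyCoeff_eq_frob m _ h0 h1]
      exact hM z ⟨h0, h1.le⟩)
  exact h

theorem connection {m : ℕ} {ν : ℝ} (hν : m < ν) :
    2 * frob m (ν * (ν + 1)) 1 * secularFactor m ν * Real.sin (Real.pi * (ν - m) / 2) =
      -frob' m (ν * (ν + 1)) 1 * Real.cos (Real.pi * (ν - m) / 2) := by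
  have key := connection_Gamma (m := m) (ν := ν)
  have hm0 : (0 : ℝ) ≤ m := m.cast_nonneg
  have e32 : Real.Gamma (3 / 2) = 1 / 2 * Real.Gamma (1 / 2) := by
    rw [show (3 : ℝ) / 2 = 1 / 2 + 1 by norm_num, Real.Gamma_add_one (by norm_num)]
  rw [inv_Gamma_eq (p := (m - ν) / 2) (by linarith),
    inv_Gamma_eq (p := (m - ν) / 2 + 1 / 2) (by linarith), e32] at key
  have g1 := Real.Gamma_pos_of_pos (show 0 < (ν + m + 1) / 2 by linarith)
  have g2 := Real.Gamma_pos_of_pos (show 0 < (ν + m + 1) / 2 + 1 / 2 by linarith)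
  have g3 := Real.Gamma_pos_of_pos (show 0 < (ν - m + 1) / 2 by linarith)
  have g4 := Real.Gamma_pos_of_pos (show (0 : ℝ) < 1 / 2 by norm_num)
  have s1 : Real.sin (Real.pi * ((m - ν) / 2)) = -Real.sin (Real.pi * (ν - m) / 2) := by
    rw [← Real.sin_neg]; congr 1; ring
  have s2 : Real.sin (Real.pi * ((m - ν) / 2 + 1 / 2)) = Real.cos (Real.pi * (ν - m) / 2) := by
    rw [← Real.cos_neg, ← Real.sin_add_pi_div_two]; congr 1; ring
  rw [s1, s2, show 1 - ((m : ℝ) - ν) / 2 = (ν - m + 1) / 2 + 1 / 2 by ring,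
    show 1 - (((m : ℝ) - ν) / 2 + 1 / 2) = (ν - m + 1) / 2 by ring] at key
  unfold secularFactor gammaQuot
  have hp := Real.pi_pos
  generalize Real.sin (Real.pi * (ν - m) / 2) = s at *
  generalize Real.cos (Real.pi * (ν - m) / 2) = c at *
  generalize Real.Gamma ((ν + m + 1) / 2) = G1 at *
  generalize Real.Gamma ((ν + m + 1) / 2 + 1 / 2) = G2 at *
  generalize Real.Gamma ((ν - m + 1) / 2) = G3 at *
  generalize Real.Gamma ((ν - m + 1) / 2 + 1 / 2) = G4 at *
  generalize Real.Gamma (1 / 2) = G5 at *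
  generalize frob m (ν * (ν + 1)) 1 = α at *
  generalize frob' m (ν * (ν + 1)) 1 = β at *
  have e : 2 * α * (G2 / G1 * (G4 / G3)) * s - -β * c =
      -(2 * Real.pi * G2 / (G3 * G5)) *
        (α * (G4 * -s / Real.pi * G1⁻¹ * G5) + -β * (G3 * c / Real.pi * G2⁻¹ * (1 / 2 * G5))) := by
    field_simp
    ring
  rw [key, mul_zero] at e
  exact sub_eq_zero.1 e

theorem exists_degree {m : ℕ} {lam : ℝ} (h : (m : ℝ) * (m + 1) < lam) :
    ∃ ν : ℝ, m < ν ∧ lam = ν * (ν + 1) := by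
  have hm : (0 : ℝ) ≤ m := m.cast_nonneg
  have h0 : 0 ≤ 1 + 4 * lam := by nlinarith
  have hs := Real.sq_sqrt h0
  refine ⟨(√(1 + 4 * lam) - 1) / 2, ?_, ?_⟩
  · have : 2 * (m : ℝ) + 1 < √(1 + 4 * lam) := Real.lt_sqrt_of_sq_lt (by nlinarith)
    linarith
  · nlinarith

theorem robin_condition_iff {σ : ℝ} (hσ : 0 < σ) (m : ℕ) (lam : ℝ) :
    -frob' m lam 1 = σ * frob m lam 1 ↔ ∃ (l : ℕ) (ν : ℝ), m ≤ l ∧ m ≡ l [MOD 2] ∧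
      ν ∈ Set.Ioo (l : ℝ) (l + 1) ∧ secular m ν = σ ∧ lam = ν * (ν + 1) := by
  have hne := frob_one_ne_zero_or m lam
  have main : ∀ ν : ℝ, m < ν → lam = ν * (ν + 1) →
      (-frob' m lam 1 = σ * frob m lam 1 ↔ secular m ν = σ) := by
    rintro ν hν rfl
    have hc := connection hν
    rw [secular_eq_of_modEq (Nat.ModEq.refl m), Real.tan_eq_sin_div_cos]
    have hG := secularFactor_pos hν.le
    have hsc := Real.sin_sq_add_cos_sq (Real.pi * (ν - m) / 2)
    set s := Real.sin (Real.pi * (ν - m) / 2)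
    set c := Real.cos (Real.pi * (ν - m) / 2)
    set G := secularFactor m ν
    set α := frob m (ν * (ν + 1)) 1
    set β := frob' m (ν * (ν + 1)) 1
    constructor
    · intro h
      have hα : α ≠ 0 := by
        intro hα
        rw [hα, mul_zero, neg_eq_zero] at h
        tauto
      rw [h] at hc
      have h1 : 2 * G * s = σ * c := by
        apply mul_left_cancel₀ hα; linear_combination hc
      have hc0 : c ≠ 0 := by
        intro h2
        rw [h2, mul_zero] at h1
        have : s = 0 := by
          rcases mul_eq_zero.1 h1 with h3 | h3
          · linarith
          · exact h3
        rw [h2, this] at hsc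
        norm_num at hsc
      field_simp
      linear_combination h1
    · intro h
      have hc0 : c ≠ 0 := by
        intro h2
        rw [h2, div_zero, mul_zero, zero_mul] at h
        linarith
      field_simp at h
      apply mul_right_cancel₀ hc0
      linear_combination -hc + α * h
  constructor
  · intro h
    rcases le_or_gt lam (m * (m + 1)) with hle | hgt
    · exfalso
      have h1 := one_le_frob_one hle
      have h2 := frobCoeff_one_le_frob' hle
      have h3 : 0 ≤ ((m : ℝ) * (m + 1) - lam) / (2 * (m + 1)) :=
        div_nonneg (by linarith) (by positivity)
      nlinarith
    · obtain ⟨ν, hν, hl⟩ := exists_degree hgt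
      have hs := (main ν hν hl).1 h
      obtain ⟨l, h1, h2, h3⟩ := le_of_secular_pos hν.le (hs ▸ hσ)
      exact ⟨l, ν, h1, h2, h3, hs, hl⟩
  · rintro ⟨l, ν, h1, h2, h3, hs, hl⟩
    have : (m : ℝ) ≤ l := by exact_mod_cast h1
    exact (main ν (this.trans_lt h3.1) hl).2 hs

theorem neumann_condition_iff (m : ℕ) (lam : ℝ) :
    frob' m lam 1 = 0 ↔ ∃ l : ℕ, m ≤ l ∧ m ≡ l [MOD 2] ∧ lam = l * (l + 1) := by
  have hne := frob_one_ne_zero_or m lam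
  have main : ∀ ν : ℝ, m < ν → lam = ν * (ν + 1) →
      (frob' m lam 1 = 0 ↔ Real.sin (Real.pi * (ν - m) / 2) = 0) := by
    rintro ν hν rfl
    have hc := connection hν
    have hG := secularFactor_pos hν.le
    have hsc := Real.sin_sq_add_cos_sq (Real.pi * (ν - m) / 2)
    constructor
    · intro h
      rw [h, neg_zero, zero_mul] at hc
      simp only [mul_eq_zero] at hc
      have := hG.ne'
      rcases hc with ((h1 | h1) | h1) | h1
      · norm_num at h1
      · tauto
      · exact absurd h1 this
      · exact h1
    · intro h
      rw [h, mul_zero] at hc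
      rcases mul_eq_zero.1 hc.symm with h1 | h1
      · exact neg_eq_zero.1 h1
      · rw [h, h1] at hsc; norm_num at hsc
  constructor
  · intro h
    rcases lt_trichotomy lam (m * (m + 1)) with hlt | heq | hgt
    · exfalso
      have h2 := frobCoeff_one_le_frob' hlt.le
      have h3 : 0 < ((m : ℝ) * (m + 1) - lam) / (2 * (m + 1)) :=
        div_pos (by linarith) (by positivity)
      linarith
    · exact ⟨m, le_rfl, Nat.ModEq.refl m, heq⟩
    · obtain ⟨ν, hν, hl⟩ := exists_degree hgt
      obtain ⟨n, hn⟩ := Real.sin_eq_zero_iff.1 ((main ν hν hl).1 h)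
      have hp := Real.pi_pos
      have hn2 : ν = m + 2 * n := by
        have : Real.pi * (n - (ν - m) / 2) = 0 := by linear_combination hn
        rcases mul_eq_zero.1 this with h1 | h1
        · exact absurd h1 hp.ne'
        · linarith
      have hn0 : (0 : ℤ) ≤ n := by
        have : (0 : ℝ) < n := by linarith
        exact_mod_cast this.le
      lift n to ℕ using hn0
      refine ⟨m + 2 * n, by omega, by unfold Nat.ModEq; omega, ?_⟩
      rw [hl, hn2]; push_cast; ring
  · rintro ⟨l, h1, h2, rfl⟩
    rcases h1.eq_or_lt with rfl | hlt
    · exact frob'_eq_zero m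
    · rw [main l (by exact_mod_cast hlt) rfl]
      obtain ⟨k, rfl⟩ : ∃ k, l = m + 2 * k := ⟨(l - m) / 2, by unfold Nat.ModEq at h2; omega⟩
      rw [show Real.pi * (((m + 2 * k : ℕ) : ℝ) - m) / 2 = k * Real.pi by push_cast; ring]
      exact Real.sin_nat_mul_pi k

/-- The point of the unit sphere with latitude `s` and longitude `φ`. -/
noncomputable def spherePt (s φ : ℝ) : E3 :=
  !₂[Real.cos s * Real.cos φ, Real.cos s * Real.sin φ, Real.sin s]

/-- The unit vector tangent to the meridian at the point with latitude `s` and longitude `φ`. -/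
noncomputable def meridianVec (s φ : ℝ) : E3 :=
  !₂[-Real.sin s * Real.cos φ, -Real.sin s * Real.sin φ, Real.cos s]

/-- The unit vector tangent to the parallels at longitude `φ`. -/
noncomputable def parallelVec (φ : ℝ) : E3 := !₂[-Real.sin φ, Real.cos φ, 0]

/-- The horizontal unit vector of longitude `φ`. -/
noncomputable def horizontalVec (φ : ℝ) : E3 := !₂[Real.cos φ, Real.sin φ, 0]

theorem hasDerivAt_vec3 {a b c : ℝ → ℝ} {a' b' c' t : ℝ} (ha : HasDerivAt a a' t)
    (hb : HasDerivAt b b' t) (hc : HasDerivAt c c' t) :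
    HasDerivAt (fun t => (!₂[a t, b t, c t] : E3)) !₂[a', b', c'] t := by
  have h : HasDerivAt (fun t => ![a t, b t, c t]) ![a', b', c'] t := by
    rw [hasDerivAt_pi]
    intro i
    fin_cases i
    · simpa using ha
    · simpa using hb
    · simpa using hc
  exact (PiLp.continuousLinearEquiv 2 ℝ fun _ : Fin 3 => ℝ).symm.toContinuousLinearMap.hasFDerivAt.comp_hasDerivAt t h

theorem hasDerivAt_spherePt_latitude (s φ : ℝ) :
    HasDerivAt (fun s => spherePt s φ) (meridianVec s φ) s :=
  hasDerivAt_vec3 ((Real.hasDerivAt_cos s).mul_const _) ((Real.hasDerivAt_cos s).mul_const _)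
    (Real.hasDerivAt_sin s)

theorem hasDerivAt_meridianVec (s φ : ℝ) :
    HasDerivAt (fun s => meridianVec s φ) (-spherePt s φ) s := by
  convert! hasDerivAt_vec3 ((Real.hasDerivAt_sin s).neg.mul_const (Real.cos φ))
    ((Real.hasDerivAt_sin s).neg.mul_const (Real.sin φ)) (Real.hasDerivAt_cos s) using 1
  ext i
  fin_cases i <;> simp [spherePt]

theorem hasDerivAt_spherePt_longitude (s φ : ℝ) :
    HasDerivAt (fun φ => spherePt s φ) (Real.cos s • parallelVec φ) φ := by
  convert! hasDerivAt_vec3 ((Real.hasDerivAt_cos φ).const_mul (Real.cos s))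
    ((Real.hasDerivAt_sin φ).const_mul (Real.cos s)) (hasDerivAt_const φ (Real.sin s)) using 1
  ext i
  fin_cases i <;> simp [parallelVec]

theorem hasDerivAt_parallelVec (φ : ℝ) :
    HasDerivAt parallelVec (-horizontalVec φ) φ := by
  convert! hasDerivAt_vec3 (Real.hasDerivAt_sin φ).neg (Real.hasDerivAt_cos φ)
    (hasDerivAt_const φ (0 : ℝ)) using 1
  ext i
  fin_cases i <;> simp [horizontalVec]

theorem horizontalVec_eq (s φ : ℝ) :
    horizontalVec φ = Real.cos s • spherePt s φ - Real.sin s • meridianVec s φ := by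
  have h := Real.sin_sq_add_cos_sq s
  ext i
  fin_cases i <;> simp [horizontalVec, spherePt, meridianVec]
  · linear_combination -Real.cos φ * h
  · linear_combination -Real.sin φ * h
  · ring

theorem inner_vec3 (a b c a' b' c' : ℝ) :
    inner ℝ (!₂[a, b, c] : E3) !₂[a', b', c'] = a * a' + b * b' + c * c' := by
  simp [PiLp.inner_apply, Fin.sum_univ_three, mul_comm]

theorem orthonormal_frame (s φ : ℝ) :
    Orthonormal ℝ ![meridianVec s φ, parallelVec φ, spherePt s φ] := by
  have h := Real.sin_sq_add_cos_sq s
  have h' := Real.sin_sq_add_cos_sq φ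
  rw [orthonormal_iff_ite]
  intro i j
  fin_cases i <;> fin_cases j <;>
    simp only [meridianVec, parallelVec, spherePt, Fin.zero_eta, Fin.mk_one, Fin.reduceFinMk,
      Matrix.cons_val_zero, Matrix.cons_val_one, Matrix.cons_val, inner_vec3, Fin.reduceEq,
      reduceIte] <;>
    norm_num
  · linear_combination h + Real.sin s ^ 2 * h'
  · ring
  · linear_combination -Real.sin s * Real.cos s * h'
  · ring
  · linear_combination h'
  · ring
  · linear_combination -Real.sin s * Real.cos s * h'
  · ring
  · linear_combination h + Real.cos s ^ 2 * h'

/-- The orthonormal basis of meridian, parallel and radial directions. -/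
noncomputable def frame (s φ : ℝ) : OrthonormalBasis (Fin 3) ℝ E3 :=
  OrthonormalBasis.mk (orthonormal_frame s φ)
    ((orthonormal_frame s φ).linearIndependent.span_eq_top_of_card_eq_finrank (by simp)).ge

theorem second_deriv_along_curve {E : Type*} [NormedAddCommGroup E] [NormedSpace ℝ E]
    {G : E → ℂ} {γ γ' : ℝ → E} {γ'' : E} {t₀ : ℝ} {h h' : ℝ → ℂ} {h'' : ℂ}
    (hG : ContDiffAt ℝ 2 G (γ t₀)) (hγ : ∀ t, HasDerivAt γ (γ' t) t)
    (hγ' : HasDerivAt γ' γ'' t₀) (he : ∀ᶠ t in 𝓝 t₀, G (γ t) = h t)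
    (hh : ∀ᶠ t in 𝓝 t₀, HasDerivAt h (h' t) t) (hh' : HasDerivAt h' h'' t₀) :
    fderiv ℝ G (γ t₀) (γ' t₀) = h' t₀ ∧
      fderiv ℝ (fderiv ℝ G) (γ t₀) (γ' t₀) (γ' t₀) + fderiv ℝ G (γ t₀) γ'' = h'' := by
  have hγc : ContinuousAt γ t₀ := (hγ t₀).continuousAt
  have hev : ∀ᶠ t in 𝓝 t₀, DifferentiableAt ℝ G (γ t) := by
    have h1 : ∀ᶠ p in 𝓝 (γ t₀), ContDiffAt ℝ 2 G p := hG.eventually (by simp)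
    filter_upwards [hγc.eventually h1] with t ht using ht.differentiableAt (by norm_num)
  have h1 : ∀ᶠ t in 𝓝 t₀, fderiv ℝ G (γ t) (γ' t) = h' t := by
    filter_upwards [hev, hh, he.eventually_nhds] with t ht1 ht2 ht3
    have a := ht1.hasFDerivAt.comp_hasDerivAt t (hγ t)
    exact (a.congr_of_eventuallyEq (ht3.mono fun x hx => hx.symm)).unique ht2
  refine ⟨h1.self_of_nhds, ?_⟩
  have hD : DifferentiableAt ℝ (fderiv ℝ G) (γ t₀) :=
    (hG.fderiv_right (m := 1) (by norm_num)).differentiableAt (by norm_num)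
  have a := (hD.hasFDerivAt.comp_hasDerivAt t₀ (hγ t₀)).clm_apply hγ'
  exact (a.congr_of_eventuallyEq (h1.mono fun x hx => hx.symm)).unique hh'

theorem laplacian_eq_frame (G : E3 → ℂ) (s φ : ℝ) :
    Δ G (spherePt s φ) =
      fderiv ℝ (fderiv ℝ G) (spherePt s φ) (meridianVec s φ) (meridianVec s φ) +
      fderiv ℝ (fderiv ℝ G) (spherePt s φ) (parallelVec φ) (parallelVec φ) +
      fderiv ℝ (fderiv ℝ G) (spherePt s φ) (spherePt s φ) (spherePt s φ) := by
  rw [InnerProductSpace.laplacian_eq_iteratedFDeriv_orthonormalBasis G (frame s φ)]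
  simp [Fin.sum_univ_three, iteratedFDeriv_two_apply, frame]

theorem laplacian_of_sector {G : E3 → ℂ} {m : ℕ} {s φ : ℝ} {g g' : ℝ → ℂ} {g'' : ℂ}
    (hG : ContDiffAt ℝ 2 G (spherePt s φ)) (hs : Real.cos s ≠ 0)
    (hhom : ∀ t : ℝ, 0 < t → G (t • spherePt s φ) = G (spherePt s φ))
    (hsec : ∀ᶠ s' in 𝓝 s, ∀ φ' : ℝ,
      G (spherePt s' φ') = Complex.exp (Complex.I * m * φ') * g s')
    (hg : ∀ᶠ s' in 𝓝 s, HasDerivAt g (g' s') s') (hg' : HasDerivAt g' g'' s) :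
    Δ G (spherePt s φ) = Complex.exp (Complex.I * m * φ) *
      (g'' - Real.tan s * g' s - m ^ 2 / Real.cos s ^ 2 * g s) := by
  set e := Complex.exp (Complex.I * m * φ) with he
  obtain ⟨m1, m2⟩ := second_deriv_along_curve (γ := fun s => spherePt s φ)
    (γ' := fun s => meridianVec s φ) (h := fun s => e * g s) (h' := fun s => e * g' s) hG
    (fun s => hasDerivAt_spherePt_latitude s φ) (hasDerivAt_meridianVec s φ)
    (hsec.mono fun s' h => h φ) (hg.mono fun s' h => h.const_mul e) (hg'.const_mul e)
  have hexp : ∀ t : ℝ, HasDerivAt (fun t : ℝ => Complex.exp (Complex.I * m * t))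
      (Complex.exp (Complex.I * m * t) * (Complex.I * m)) t := fun t => by
    have h := ((Complex.ofRealCLM.hasDerivAt (x := t)).const_mul (Complex.I * m)).cexp
    simpa using h
  obtain ⟨-, p2⟩ := second_deriv_along_curve (γ := fun φ => spherePt s φ)
    (γ' := fun φ => Real.cos s • parallelVec φ)
    (h := fun t => Complex.exp (Complex.I * m * t) * g s)
    (h' := fun t => Complex.exp (Complex.I * m * t) * (Complex.I * m) * g s) hG
    (fun φ => hasDerivAt_spherePt_longitude s φ) ((hasDerivAt_parallelVec φ).const_smul (Real.cos s))
    (Eventually.of_forall fun φ' => hsec.self_of_nhds φ')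
    (Eventually.of_forall fun t => (hexp t).mul_const (g s))
    (((hexp φ).mul_const (Complex.I * m)).mul_const (g s))
  obtain ⟨r1, r2⟩ := second_deriv_along_curve (γ := fun t : ℝ => t • spherePt s φ) (t₀ := 1)
    (γ' := fun _ => spherePt s φ) (γ'' := 0)
    (h := fun _ => G (spherePt s φ)) (h' := fun _ => 0) (h'' := 0) (by simpa using hG)
    (fun t => by simpa using (hasDerivAt_id t).smul_const (spherePt s φ))
    (hasDerivAt_const _ _)
    ((eventually_gt_nhds one_pos).mono fun t ht => hhom t ht)
    (Eventually.of_forall fun t => hasDerivAt_const _ _) (hasDerivAt_const _ _)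
  simp only [one_smul, map_zero, add_zero] at r1 r2
  rw [map_neg, r1, neg_zero, add_zero] at m2
  simp only [map_smul, smul_neg, smul_apply, map_neg] at p2
  rw [horizontalVec_eq s φ, map_sub, map_smul, map_smul, r1, m1] at p2
  rw [laplacian_eq_frame, m2, r2, add_zero, Real.tan_eq_sin_div_cos]
  simp only [Complex.real_smul, smul_zero, zero_sub] at p2
  have hc : (Real.cos s : ℂ) ≠ 0 := by exact_mod_cast hs
  rw [← he] at p2
  push_cast at p2 hc ⊢
  field_simp
  linear_combination p2 + e * (m : ℂ) ^ 2 * g s * Complex.I_sq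

theorem radialExt_val (F : Hemisphere → ℂ) (p : Hemisphere) : radialExt F p.1 = F p := by
  rw [radialExt, p.2.1, inv_one, one_smul, Subtype.val_injective.extend_apply]

theorem radialExt_smul_pos (F : Hemisphere → ℂ) {t : ℝ} (ht : 0 < t) (p : E3) :
    radialExt F (t • p) = radialExt F p := by
  rw [radialExt, radialExt, norm_smul, Real.norm_of_nonneg ht.le, smul_smul]
  congr 2
  field_simp

theorem norm_spherePt (s φ : ℝ) : ‖spherePt s φ‖ = 1 := by
  simpa using (orthonormal_frame s φ).1 2

/-- The point of the hemisphere with latitude `s` and longitude `φ`. -/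
noncomputable def hemiPt (s φ : ℝ) (h : 0 ≤ Real.sin s) : Hemisphere :=
  ⟨spherePt s φ, norm_spherePt s φ, by simpa [spherePt] using h⟩

theorem rotate_hemiPt (s φ : ℝ) (h : 0 ≤ Real.sin s) :
    rotate φ (hemiPt s 0 h) = hemiPt s φ h := by
  apply Subtype.ext
  ext i
  fin_cases i <;> simp [rotate, hemiPt, spherePt, mul_comm]

theorem radialExt_spherePt_of_inSector {F : Hemisphere → ℂ} {m : ℕ} (hF : InSector m F) {s : ℝ}
    (h : 0 ≤ Real.sin s) (φ : ℝ) : radialExt F (spherePt s φ) =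
      Complex.exp (Complex.I * m * φ) * radialExt F (spherePt s 0) := by
  have h1 := radialExt_val F (hemiPt s φ h)
  have h2 := radialExt_val F (hemiPt s 0 h)
  change radialExt F (spherePt s φ) = _ at h1
  change radialExt F (spherePt s 0) = _ at h2
  rw [h1, h2, ← rotate_hemiPt, hF]

theorem exists_eq_spherePt (p : Hemisphere) :
    ∃ s ∈ Set.Icc 0 (Real.pi / 2), ∃ φ : ℝ, p.1 = spherePt s φ := by
  have hn := p.2.1
  rw [EuclideanSpace.norm_eq, Real.sqrt_eq_one] at hn
  simp only [Fin.sum_univ_three, Real.norm_eq_abs, sq_abs] at hn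
  have h0 := p.2.2
  have h1 : p.1 2 ≤ 1 := by nlinarith [sq_nonneg (p.1 0), sq_nonneg (p.1 1)]
  set w : ℂ := ⟨p.1 0, p.1 1⟩ with hw
  have hnorm : ‖w‖ = √(1 - p.1 2 ^ 2) := by
    rw [Complex.norm_eq_sqrt_sq_add_sq]; congr 1; simp only [hw]; linarith
  refine ⟨Real.arcsin (p.1 2), ⟨Real.arcsin_nonneg.2 h0, Real.arcsin_le_pi_div_two _⟩, w.arg, ?_⟩
  ext i
  fin_cases i
  · simp [spherePt, Real.cos_arcsin, ← hnorm, hw]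
  · simp [spherePt, Real.cos_arcsin, ← hnorm, hw]
  · simp [spherePt, Real.sin_arcsin (by linarith) h1]

theorem eq_zero_of_interior_ode {E : Type*} [NormedAddCommGroup E] [NormedSpace ℝ E]
    {y y' : ℝ → E} {p q : ℝ → ℝ} {a b : ℝ} (hab : a < b)
    (hy : ContinuousOn y (Set.Icc a b)) (hy' : ContinuousOn y' (Set.Icc a b))
    (hd : ∀ t ∈ Set.Ioo a b, HasDerivAt y (y' t) t)
    (hd' : ∀ t ∈ Set.Ioo a b, HasDerivAt y' (p t • y' t + q t • y t) t)
    (hp : ContinuousOn p (Set.Icc a b)) (hq : ContinuousOn q (Set.Icc a b))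
    (h0 : y a = 0) (h0' : y' a = 0) {t : ℝ} (ht : t ∈ Set.Icc a b) : y t = 0 := by
  obtain ⟨K₁, hK₁⟩ := isCompact_Icc.exists_bound_of_continuousOn hp
  obtain ⟨K₂, hK₂⟩ := isCompact_Icc.exists_bound_of_continuousOn hq
  have ext_right : ∀ {f f' : ℝ → E}, ContinuousOn f (Set.Icc a b) → ContinuousOn f' (Set.Icc a b) →
      (∀ t ∈ Set.Ioo a b, HasDerivAt f (f' t) t) →
      ∀ t ∈ Set.Ico a b, HasDerivWithinAt f (f' t) (Set.Ici t) t := by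
    intro f f' hf hf' hd t ht
    rcases ht.1.eq_or_lt with rfl | hlt
    · refine hasDerivWithinAt_Ici_of_tendsto_deriv (s := Set.Ioo a b)
        (fun t ht => (hd t ht).differentiableAt.differentiableWithinAt)
        ((hf a ⟨le_rfl, hab.le⟩).mono Set.Ioo_subset_Icc_self) (Ioo_mem_nhdsGT hab) ?_
      have h1 : Tendsto f' (𝓝[Set.Ioo a b] a) (𝓝 (f' a)) :=
        (hf' a ⟨le_rfl, hab.le⟩).mono Set.Ioo_subset_Icc_self
      rw [nhdsWithin_Ioo_eq_nhdsGT hab] at h1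
      refine h1.congr' ?_
      filter_upwards [Ioo_mem_nhdsGT hab] with x hx using (hd x hx).deriv.symm
    · exact (hd t ⟨hlt, ht.2⟩).hasDerivWithinAt
  exact eq_zero_of_second_order_ode (K := max K₁ K₂) hy hy' (ext_right hy hy' hd)
    (ext_right hy' ((hp.smul hy').add (hq.smul hy)) hd')
    (fun t ht => (hK₁ t ⟨ht.1, ht.2.le⟩).trans (le_max_left _ _))
    (fun t ht => (hK₂ t ⟨ht.1, ht.2.le⟩).trans (le_max_right _ _)) h0 h0' ht

/-- `g` is the restriction to a meridian of an eigenfunction in the `m`-th sector, as a function of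
the latitude, and `g'` its derivative. -/
structure IsMeridianProfile (σ lam : ℝ) (m : ℕ) (g g' : ℝ → ℂ) : Prop where
  cont : ContinuousOn g (Set.Icc 0 (Real.pi / 2))
  cont' : ContinuousOn g' (Set.Icc 0 (Real.pi / 2))
  deriv : ∀ s ∈ Set.Ioo 0 (Real.pi / 2), HasDerivAt g (g' s) s
  deriv' : ∀ s ∈ Set.Ioo 0 (Real.pi / 2),
    HasDerivAt g' (Real.tan s • g' s + ((m : ℝ) ^ 2 / Real.cos s ^ 2 - lam) • g s) s
  bdry : g' 0 = σ * g 0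

theorem cos_smul_add_sin_smul_north (s t φ : ℝ) (hs : Real.sin s = 0) (hc : Real.cos s = 1) :
    Real.cos t • spherePt s φ + Real.sin t • north = spherePt t φ := by
  ext i
  fin_cases i <;> simp [spherePt, north, hs, hc]

theorem spherePt_mem_puncturedHalfSpace {s φ : ℝ} (h : 0 ≤ Real.sin s) :
    spherePt s φ ∈ puncturedHalfSpace := by
  refine ⟨by simpa [spherePt] using h, fun h0 => ?_⟩
  have := norm_spherePt s φ
  rw [h0, norm_zero] at this
  exact zero_ne_one this

theorem contDiff_spherePt_latitude (φ : ℝ) {n : WithTop ℕ∞} :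
    ContDiff ℝ n fun s => spherePt s φ := by
  rw [contDiff_euclidean]
  intro i
  fin_cases i
  · simpa [spherePt] using Real.contDiff_cos.mul contDiff_const
  · simpa [spherePt] using Real.contDiff_cos.mul contDiff_const
  · simpa [spherePt] using Real.contDiff_sin

theorem sin_nonneg_of_mem {s : ℝ} (hs : s ∈ Set.Icc 0 (Real.pi / 2)) : 0 ≤ Real.sin s :=
  Real.sin_nonneg_of_nonneg_of_le_pi hs.1 (by linarith [hs.2, Real.pi_pos])

theorem isMeridianProfile_of_mem {σ lam : ℝ} {m : ℕ} {F : Hemisphere → ℂ}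
    (hF : F ∈ eigenspace σ lam m) :
    IsMeridianProfile σ lam m (fun s => radialExt F (spherePt s 0))
      (derivWithin (fun s => radialExt F (spherePt s 0)) (Set.Icc 0 (Real.pi / 2))) := by
  obtain ⟨⟨hC2, heqn, hbd⟩, hsec⟩ := hF
  have hp := Real.pi_pos
  set I := Set.Icc 0 (Real.pi / 2) with hI
  set g : ℝ → ℂ := fun s => radialExt F (spherePt s 0) with hg
  set g1 := derivWithin g I with hg1
  have hu : UniqueDiffOn ℝ I := uniqueDiffOn_Icc (by positivity)
  have hgC : ContDiffOn ℝ 2 g I :=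
    ContDiffOn.comp (g := radialExt F) (t := puncturedHalfSpace) hC2 (contDiff_spherePt_latitude 0).contDiffOn fun s hs =>
      spherePt_mem_puncturedHalfSpace (sin_nonneg_of_mem hs)
  have hg1C : ContDiffOn ℝ 1 g1 I := hgC.derivWithin hu (by norm_num)
  have hderivW : ∀ s ∈ I, HasDerivWithinAt g (g1 s) I s := fun s hs =>
    (hgC.differentiableOn (by norm_num) s hs).hasDerivWithinAt
  have hderiv : ∀ s ∈ Set.Ioo 0 (Real.pi / 2), HasDerivAt g (g1 s) s := fun s hs =>
    (hderivW s (Set.Ioo_subset_Icc_self hs)).hasDerivAt (Icc_mem_nhds hs.1 hs.2)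
  refine ⟨hgC.continuousOn, hg1C.continuousOn, hderiv, fun s hs => ?_, ?_⟩
  · have hd : DifferentiableAt ℝ g1 s := (hg1C.differentiableOn (by norm_num) s
      (Set.Ioo_subset_Icc_self hs)).differentiableAt (Icc_mem_nhds hs.1 hs.2)
    have hsin : 0 < Real.sin s := Real.sin_pos_of_pos_of_lt_pi hs.1 (by linarith [hs.2])
    have hcos : 0 < Real.cos s := Real.cos_pos_of_mem_Ioo ⟨by linarith [hs.1], hs.2⟩
    have hlap := laplacian_of_sector (G := radialExt F) (m := m) (s := s) (φ := 0) (g := g)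
      (g' := g1) (g'' := deriv g1 s) (hC2.contDiffAt (hemiPt s 0 hsin.le) (by
        simpa [hemiPt, spherePt] using hsin)) hcos.ne'
      (fun t ht => radialExt_smul_pos F ht _)
      (by
        filter_upwards [Ioo_mem_nhds hs.1 hs.2] with s' hs' φ'
        exact radialExt_spherePt_of_inSector hsec
          (sin_nonneg_of_mem (Set.Ioo_subset_Icc_self hs')) φ')
      (by filter_upwards [Ioo_mem_nhds hs.1 hs.2] with s' hs' using hderiv s' hs')
      hd.hasDerivAt
    have he := heqn (hemiPt s 0 hsin.le) (by simpa [hemiPt, spherePt] using hsin)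
    rw [← radialExt_val F, sphericalLaplacian] at he
    change Δ (radialExt F) (spherePt s 0) + lam * g s = 0 at he
    rw [hlap] at he
    simp only [Complex.ofReal_zero, mul_zero, Complex.exp_zero, one_mul] at he
    convert! hd.hasDerivAt using 1
    simp only [Complex.real_smul]
    push_cast at he ⊢
    linear_combination -he
  · have h0 : (0 : ℝ) ≤ Real.sin 0 := by simp
    obtain ⟨v, hv, hv'⟩ := hbd (hemiPt 0 0 h0) (by simp [hemiPt, spherePt])
    rw [← radialExt_val F] at hv'
    change v + σ * g 0 = 0 at hv'
    unfold HasOutwardNormalDeriv at hv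
    have hcurve : (fun t : ℝ => radialExt F (Real.cos t • (hemiPt 0 0 h0).1 + Real.sin t • north)) =
        g := by
      funext t
      change radialExt F (Real.cos t • spherePt 0 0 + _) = _
      rw [cos_smul_add_sin_smul_north 0 t 0 Real.sin_zero Real.cos_zero]
    rw [hcurve] at hv
    have h0I : (0 : ℝ) ∈ I := ⟨le_rfl, by positivity⟩
    have := (hu 0 h0I).eq_deriv (𝕜 := ℝ) _ (hderivW 0 h0I) (hv.mono fun x hx => hx.1)
    rw [this]
    linear_combination -hv'

theorem IsMeridianProfile.eq_zero {σ lam : ℝ} {m : ℕ} {g g' : ℝ → ℂ}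
    (h : IsMeridianProfile σ lam m g g') (h0 : g 0 = 0) {s : ℝ}
    (hs : s ∈ Set.Icc 0 (Real.pi / 2)) : g s = 0 := by
  have hp := Real.pi_pos
  have hlt : ∀ s, 0 < s → s < Real.pi / 2 → g s = 0 := by
    intro s hs0 hs1
    have hcos : ∀ t ∈ Set.Icc 0 s, Real.cos t ≠ 0 := fun t ht =>
      (Real.cos_pos_of_mem_Ioo ⟨by linarith [ht.1], by linarith [ht.2]⟩).ne'
    have hsub : Set.Icc 0 s ⊆ Set.Icc 0 (Real.pi / 2) := Set.Icc_subset_Icc_right hs1.le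
    refine eq_zero_of_interior_ode (p := Real.tan)
      (q := fun s => (m : ℝ) ^ 2 / Real.cos s ^ 2 - lam) hs0 (h.cont.mono hsub) (h.cont'.mono hsub)
      (fun t ht => h.deriv t ⟨ht.1, ht.2.trans hs1⟩) (fun t ht => h.deriv' t ⟨ht.1, ht.2.trans hs1⟩)
      (fun t ht => (Real.continuousAt_tan.2 (hcos t ht)).continuousWithinAt)
      (ContinuousOn.sub (ContinuousOn.div (by fun_prop) (by fun_prop)
        fun t ht => pow_ne_zero 2 (hcos t ht)) (by fun_prop)) h0 (by rw [h.bdry, h0, mul_zero])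
      ⟨hs0.le, le_rfl⟩
  have hcl : Set.Icc 0 (Real.pi / 2) ⊆ closure (Set.Ioo 0 (Real.pi / 2)) := by
    rw [closure_Ioo (by positivity)]
  exact Set.EqOn.of_subset_closure (g := fun _ => 0) (fun t ht => hlt t ht.1 ht.2) h.cont
    continuousOn_const Set.Ioo_subset_Icc_self hcl hs

theorem eq_zero_of_mem_eigenspace {σ lam : ℝ} {m : ℕ} {F : Hemisphere → ℂ}
    (hF : F ∈ eigenspace σ lam m) (h0 : radialExt F (spherePt 0 0) = 0) : F = 0 := by
  funext p
  obtain ⟨s, hs, φ, hp⟩ := exists_eq_spherePt p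
  rw [← radialExt_val F p, hp, radialExt_spherePt_of_inSector hF.2 (sin_nonneg_of_mem hs),
    (isMeridianProfile_of_mem hF).eq_zero h0 hs, mul_zero]
  rfl

theorem rank_eigenspace_le_one (σ lam : ℝ) (m : ℕ) :
    Module.rank ℂ (eigenspace σ lam m) ≤ 1 := by
  let ev : eigenspace σ lam m →ₗ[ℂ] ℂ :=
    { toFun := fun F => radialExt F.1 (spherePt 0 0)
      map_add' := fun F G => by
        rw [Submodule.coe_add, radialExt_add, Pi.add_apply]
      map_smul' := fun c F => by
        rw [Submodule.coe_smul, radialExt_smul, Pi.smul_apply, RingHom.id_apply] }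
  have hinj : Function.Injective ev := by
    rw [injective_iff_map_eq_zero]
    intro F hF
    exact Subtype.ext (eq_zero_of_mem_eigenspace F.2 hF)
  have := LinearMap.rank_le_of_injective ev hinj
  rwa [Module.rank_self] at this

/-- The meridian profile of the solution in the `m`-th sector that is regular at the pole. -/
noncomputable def profile (m : ℕ) (lam s : ℝ) : ℝ :=
  Real.cos s ^ m * frob m lam (1 - Real.sin s)

/-- The derivative of `profile` times the cosine of the latitude. -/
noncomputable def profileFlux (m : ℕ) (lam s : ℝ) : ℝ :=
  -(m * Real.cos s ^ m * Real.sin s * frob m lam (1 - Real.sin s)) -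
    Real.cos s ^ (m + 2) * frob' m lam (1 - Real.sin s)

theorem abs_one_sub_sin_lt {s : ℝ} (hs : Real.cos s ≠ 0) : |1 - Real.sin s| < 2 := by
  have h := Real.sin_sq_add_cos_sq s
  have h2 : 0 < Real.cos s ^ 2 := by positivity
  rw [abs_lt]
  constructor <;> nlinarith

theorem hasDerivAt_one_sub_sin (s : ℝ) :
    HasDerivAt (fun s => 1 - Real.sin s) (-Real.cos s) s :=
  (Real.hasDerivAt_sin s).const_sub 1

theorem hasDerivAt_frob_comp (m : ℕ) (lam : ℝ) {s : ℝ} (hs : |1 - Real.sin s| < 2) :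
    HasDerivAt (fun s => frob m lam (1 - Real.sin s))
      (frob' m lam (1 - Real.sin s) * -Real.cos s) s :=
  (hasDerivAt_frob m lam hs).comp s (hasDerivAt_one_sub_sin s)

theorem hasDerivAt_frob'_comp (m : ℕ) (lam : ℝ) {s : ℝ} (hs : |1 - Real.sin s| < 2) :
    HasDerivAt (fun s => frob' m lam (1 - Real.sin s))
      (frob'' m lam (1 - Real.sin s) * -Real.cos s) s :=
  (hasDerivAt_frob' m lam hs).comp s (hasDerivAt_one_sub_sin s)

theorem mul_pow_sub_one_mul {c : ℝ} (m : ℕ) : (m : ℝ) * c ^ (m - 1) * c = m * c ^ m := by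
  cases m with
  | zero => simp
  | succ m => rw [Nat.add_sub_cancel, pow_succ]; ring

theorem hasDerivAt_profile (m : ℕ) (lam : ℝ) {s : ℝ} (hs : Real.cos s ≠ 0) :
    HasDerivAt (profile m lam) (profileFlux m lam s / Real.cos s) s := by
  have h := ((Real.hasDerivAt_cos s).pow m).mul (hasDerivAt_frob_comp m lam (abs_one_sub_sin_lt hs))
  convert! h using 1
  simp only [Pi.pow_apply]
  rw [profileFlux, div_eq_iff hs]
  linear_combination
    (Real.sin s * frob m lam (1 - Real.sin s)) * mul_pow_sub_one_mul (c := Real.cos s) m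

theorem hasDerivAt_profileFlux (m : ℕ) (lam : ℝ) {s : ℝ} (hs : Real.cos s ≠ 0) :
    HasDerivAt (profileFlux m lam)
      (((m : ℝ) ^ 2 / Real.cos s - lam * Real.cos s) * profile m lam s) s := by
  have ha := abs_one_sub_sin_lt hs
  have h := (((((Real.hasDerivAt_cos s).pow m).const_mul (m : ℝ)).mul
    (Real.hasDerivAt_sin s)).mul (hasDerivAt_frob_comp m lam ha)).neg.sub
    (((Real.hasDerivAt_cos s).pow (m + 2)).mul (hasDerivAt_frob'_comp m lam ha))
  convert! h using 1
  have hode := frob_ode m lam ha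
  have hsc := Real.sin_sq_add_cos_sq s
  have hm := mul_pow_sub_one_mul (c := Real.cos s) m
  rw [profile]
  simp only [Pi.mul_apply, Pi.pow_apply]
  set u := frob m lam (1 - Real.sin s)
  set u' := frob' m lam (1 - Real.sin s)
  set u'' := frob'' m lam (1 - Real.sin s)
  set c := Real.cos s
  set t := Real.sin s
  rw [show m + 2 - 1 = m + 1 by omega]
  generalize c ^ (m - 1) = w at *
  have hm2 : (m : ℝ) * c ^ m / c = m * w := by rw [← hm, mul_div_cancel_right₀ _ hs]
  have hsplit : ((m : ℝ) ^ 2 / c - lam * c) * (c ^ m * u) =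
      m * u * (m * c ^ m / c) - lam * c ^ (m + 1) * u := by ring
  rw [hsplit]
  push_cast
  linear_combination (m * u) * hm2 - (m ^ 2 * w * u + c ^ (m + 1) * u'') * hsc + m * u * c * hm -
    c ^ (m + 1) * hode

theorem profile_zero (m : ℕ) (lam : ℝ) : profile m lam 0 = frob m lam 1 := by simp [profile]

theorem profileFlux_zero (m : ℕ) (lam : ℝ) : profileFlux m lam 0 = -frob' m lam 1 := by
  simp [profileFlux]

theorem abs_one_sub_sin_lt_of_mem {s : ℝ} (hs : s ∈ Set.Icc 0 (Real.pi / 2)) :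
    |1 - Real.sin s| < 2 :=
  abs_one_sub_lt_two (sin_nonneg_of_mem hs) (Real.sin_le_one s)

theorem IsMeridianProfile.robin_condition {σ lam : ℝ} {m : ℕ} {g g' : ℝ → ℂ}
    (h : IsMeridianProfile σ lam m g g') (h0 : g 0 ≠ 0) :
    -frob' m lam 1 = σ * frob m lam 1 := by
  have hp := Real.pi_pos
  set W : ℝ → ℂ := fun s => g s * (profileFlux m lam s : ℝ) -
    (Real.cos s : ℝ) * g' s * (profile m lam s : ℝ) with hW
  have hcP : ContinuousOn (profile m lam) (Set.Icc 0 (Real.pi / 2)) := fun s hs =>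
    ((Real.continuous_cos.pow m).continuousAt.mul (hasDerivAt_frob_comp m lam
      (abs_one_sub_sin_lt_of_mem hs)).continuousAt).continuousWithinAt
  have hcQ : ContinuousOn (profileFlux m lam) (Set.Icc 0 (Real.pi / 2)) := fun s hs => by
    have h1 := (hasDerivAt_frob_comp m lam (abs_one_sub_sin_lt_of_mem hs)).continuousAt
    have h2 := (hasDerivAt_frob'_comp m lam (abs_one_sub_sin_lt_of_mem hs)).continuousAt
    refine ContinuousAt.continuousWithinAt (ContinuousAt.sub (ContinuousAt.neg (ContinuousAt.mul
      (Continuous.continuousAt (by fun_prop)) h1)) (ContinuousAt.mul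
      (Continuous.continuousAt (by fun_prop)) h2))
  have hcW : ContinuousOn W (Set.Icc 0 (Real.pi / 2)) := by
    refine (h.cont.mul (Complex.continuous_ofReal.comp_continuousOn hcQ)).sub ((ContinuousOn.mul ?_
      h.cont').mul (Complex.continuous_ofReal.comp_continuousOn hcP))
    exact (Complex.continuous_ofReal.comp Real.continuous_cos).continuousOn
  have hdW : ∀ s ∈ Set.Ioo 0 (Real.pi / 2), HasDerivAt W 0 s := by
    intro s hs
    have hcos : Real.cos s ≠ 0 := (Real.cos_pos_of_mem_Ioo ⟨by linarith [hs.1], hs.2⟩).ne'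
    have d1 := ((h.deriv s hs).mul (hasDerivAt_profileFlux m lam hcos).ofReal_comp).sub
      (((Real.hasDerivAt_cos s).ofReal_comp.mul (h.deriv' s hs)).mul
        (hasDerivAt_profile m lam hcos).ofReal_comp)
    convert! d1 using 1
    simp only [Pi.mul_apply, Complex.real_smul, Real.tan_eq_sin_div_cos]
    have hcos' : (Real.cos s : ℂ) ≠ 0 := by exact_mod_cast hcos
    push_cast at hcos' ⊢
    field_simp
    ring
  have hint := intervalIntegral.integral_eq_sub_of_hasDerivAt_of_le (f := W) (f' := fun _ => 0)
    (by positivity) hcW hdW (by simp)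
  have hW1 : W (Real.pi / 2) = 0 := by
    simp only [hW, profileFlux, Real.cos_pi_div_two]
    rcases m.eq_zero_or_pos with rfl | hm
    · simp
    · simp [hm.ne']
  have hW0 : W 0 = g 0 * (-frob' m lam 1 - σ * frob m lam 1 : ℝ) := by
    simp only [hW, profileFlux_zero, profile_zero, h.bdry, Real.cos_zero]
    push_cast; ring
  rw [intervalIntegral.integral_zero, hW1, hW0, zero_sub, eq_comm, neg_eq_zero] at hint
  rcases mul_eq_zero.1 hint with h1 | h1
  · exact absurd h1 h0
  · exact sub_eq_zero.1 (by exact_mod_cast h1)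

/-- The solution in the `m`-th sector that is regular at the pole. -/
noncomputable def sectorSol (m : ℕ) (lam : ℝ) (p : Hemisphere) : ℂ :=
  (p.1 0 + p.1 1 * Complex.I) ^ m * frob m lam (1 - p.1 2)

theorem sectorSol_of_eq (m : ℕ) (lam : ℝ) {s φ : ℝ} {p : Hemisphere} (hp : p.1 = spherePt s φ) :
    sectorSol m lam p = Complex.exp (Complex.I * m * φ) * profile m lam s := by
  have e : (p.1 0 + p.1 1 * Complex.I : ℂ) = Real.cos s * Complex.exp (Complex.I * φ) := by
    rw [hp, mul_comm Complex.I, Complex.exp_mul_I]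
    simp [spherePt]
    ring
  have e2 : p.1 2 = Real.sin s := by rw [hp]; simp [spherePt]
  rw [sectorSol, e, e2, profile, mul_pow, ← Complex.exp_nat_mul]
  push_cast
  rw [show (m : ℂ) * (Complex.I * φ) = Complex.I * m * φ by ring]
  ring

theorem radialExt_sectorSol_spherePt (m : ℕ) (lam : ℝ) {s : ℝ} (h : 0 ≤ Real.sin s) (φ : ℝ) :
    radialExt (sectorSol m lam) (spherePt s φ) =
      Complex.exp (Complex.I * m * φ) * profile m lam s := by
  have := radialExt_val (sectorSol m lam) (hemiPt s φ h)
  rw [sectorSol_of_eq m lam (p := hemiPt s φ h) rfl] at this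
  exact this

theorem inSector_sectorSol (m : ℕ) (lam : ℝ) : InSector m (sectorSol m lam) := by
  intro φ p
  have e : ((rotate φ p).1 0 + (rotate φ p).1 1 * Complex.I : ℂ) =
      Complex.exp (Complex.I * φ) * (p.1 0 + p.1 1 * Complex.I) := by
    rw [mul_comm Complex.I, Complex.exp_mul_I]
    simp [rotate]
    linear_combination -(Complex.sin φ * p.1 1) * Complex.I_sq
  have e2 : (rotate φ p).1 2 = p.1 2 := by simp [rotate]
  rw [sectorSol, sectorSol, e, e2, mul_pow, ← Complex.exp_nat_mul,
    show (m : ℂ) * (Complex.I * φ) = Complex.I * m * φ by ring]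
  ring

theorem isC2_sectorSol (m : ℕ) (lam : ℝ) : IsC2 (sectorSol m lam) := by
  have hcoord : ∀ i : Fin 3, ContDiff ℝ 2 fun p : E3 => p i := fun i =>
    contDiff_euclidean.1 contDiff_id i
  have hofReal : ContDiff ℝ 2 (fun x : ℝ => (x : ℂ)) := Complex.ofRealCLM.contDiff
  have hninv : ContDiffOn ℝ 2 (fun p : E3 => ‖p‖⁻¹) puncturedHalfSpace := fun p hp =>
    ((contDiffAt_norm ℝ hp.2).inv (norm_ne_zero_iff.2 hp.2)).contDiffWithinAt
  have hscal : ∀ i : Fin 3, ContDiffOn ℝ 2 (fun p : E3 => ‖p‖⁻¹ * p i) puncturedHalfSpace :=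
    fun i => hninv.mul (hcoord i).contDiffOn
  have habs : ∀ p ∈ puncturedHalfSpace, 0 ≤ ‖p‖⁻¹ * p 2 ∧ ‖p‖⁻¹ * p 2 ≤ 1 := by
    intro p hp
    have hn : 0 < ‖p‖ := norm_pos_iff.2 hp.2
    refine ⟨mul_nonneg (by positivity) hp.1, ?_⟩
    rw [inv_mul_le_iff₀ hn, mul_one]
    exact (le_abs_self _).trans (by simpa using PiLp.norm_apply_le p 2)
  have hfrob : ContDiffOn ℝ 2 (fun p : E3 => frob m lam (1 - ‖p‖⁻¹ * p 2)) puncturedHalfSpace := by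
    refine ContDiffOn.comp (t := Set.Ioo (-2) 2) ((absConv_frobCoeff m lam).contDiffOn 2)
      (contDiffOn_const.sub (hscal 2)) fun p hp => ?_
    obtain ⟨h1, h2⟩ := habs p hp
    exact ⟨by linarith, by linarith⟩
  have hmain : ContDiffOn ℝ 2 (fun p : E3 => (((‖p‖⁻¹ * p 0 : ℝ) : ℂ) +
      ((‖p‖⁻¹ * p 1 : ℝ) : ℂ) * Complex.I) ^ m * (frob m lam (1 - ‖p‖⁻¹ * p 2) : ℂ))
      puncturedHalfSpace :=
    (((hofReal.comp_contDiffOn (hscal 0)).add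
      ((hofReal.comp_contDiffOn (hscal 1)).mul contDiffOn_const)).pow m).mul
      (hofReal.comp_contDiffOn hfrob)
  refine ContDiffOn.congr hmain fun p hp => ?_
  have hn : 0 < ‖p‖ := norm_pos_iff.2 hp.2
  let q : Hemisphere := ⟨‖p‖⁻¹ • p, by
    rw [norm_smul, norm_inv, norm_norm, inv_mul_cancel₀ hn.ne'], by simpa using (habs p hp).1⟩
  rw [← radialExt_smul_pos _ (inv_pos.2 hn), show ‖p‖⁻¹ • p = q.1 from rfl, radialExt_val,
    sectorSol]
  simp [q]

theorem continuousAt_laplacian {F : Hemisphere → ℂ} (hF : IsC2 F) (p : Hemisphere)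
    (hp : 0 < p.1 2) : ContinuousAt (Δ (radialExt F)) p.1 := by
  have hC := hF.contDiffAt p hp
  rw [InnerProductSpace.laplacian_eq_iteratedFDeriv_orthonormalBasis _ (frame 0 0)]
  simp only [iteratedFDeriv_two_apply]
  have h1 : ContinuousAt (fderiv ℝ (fderiv ℝ (radialExt F))) p.1 :=
    ((hC.fderiv_right (m := 1) (by norm_num)).fderiv_right (m := 0) (by norm_num)).continuousAt
  refine tendsto_finsetSum _ fun i _ => ?_
  exact (h1.clm_apply continuousAt_const).clm_apply continuousAt_const

theorem sectorSol_eqn_of_lt (m : ℕ) (lam : ℝ) {s : ℝ} (hs : s ∈ Set.Ioo 0 (Real.pi / 2)) (φ : ℝ) :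
    Δ (radialExt (sectorSol m lam)) (spherePt s φ) +
      lam * radialExt (sectorSol m lam) (spherePt s φ) = 0 := by
  have hsin : 0 < Real.sin s := Real.sin_pos_of_pos_of_lt_pi hs.1 (by linarith [hs.2, Real.pi_pos])
  have hcosm : ∀ s' ∈ Set.Ioo 0 (Real.pi / 2), Real.cos s' ≠ 0 := fun s' hs' =>
    (Real.cos_pos_of_mem_Ioo ⟨by linarith [hs'.1, Real.pi_pos], hs'.2⟩).ne'
  have hcos := hcosm s hs
  have hd := ((hasDerivAt_profileFlux m lam hcos).div (Real.hasDerivAt_cos s) hcos).ofReal_comp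
  rw [laplacian_of_sector (m := m) (g := fun s => (profile m lam s : ℂ))
    (g' := fun s => ((profileFlux m lam s / Real.cos s : ℝ) : ℂ))
    ((isC2_sectorSol m lam).contDiffAt (hemiPt s φ hsin.le) (by
        simpa [hemiPt, spherePt] using hsin)) hcos (fun t ht => radialExt_smul_pos _ ht _)
    (by
      filter_upwards [Ioo_mem_nhds hs.1 hs.2] with s' hs' φ'
      exact radialExt_sectorSol_spherePt m lam
        (sin_nonneg_of_mem (Set.Ioo_subset_Icc_self hs')) φ')
    (by
      filter_upwards [Ioo_mem_nhds hs.1 hs.2] with s' hs'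
      exact (hasDerivAt_profile m lam (hcosm s' hs')).ofReal_comp) hd,
    radialExt_sectorSol_spherePt m lam hsin.le, Real.tan_eq_sin_div_cos]
  have hcos' : (Real.cos s : ℂ) ≠ 0 := by exact_mod_cast hcos
  push_cast at hcos' ⊢
  field_simp
  ring

theorem sectorSol_eqn (m : ℕ) (lam : ℝ) (p : Hemisphere) (hp : 0 < p.1 2) :
    sphericalLaplacian (sectorSol m lam) p + (lam : ℂ) * sectorSol m lam p = 0 := by
  have hpi := Real.pi_pos
  obtain ⟨s, hs, φ, h⟩ := exists_eq_spherePt p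
  have hs0 : 0 < s := by
    rcases hs.1.eq_or_lt with h0 | h0
    · rw [h, ← h0] at hp; simp [spherePt] at hp
    · exact h0
  rw [← radialExt_val (sectorSol m lam), sphericalLaplacian]
  have hC : ContinuousAt (fun q => Δ (radialExt (sectorSol m lam)) q +
      (lam : ℂ) * radialExt (sectorSol m lam) q) p.1 :=
    (continuousAt_laplacian (isC2_sectorSol m lam) p hp).add
      (((isC2_sectorSol m lam).contDiffAt p hp).continuousAt.const_mul _)
  rw [h] at hC ⊢
  have hC2 : Tendsto (fun t => Δ (radialExt (sectorSol m lam)) (spherePt t φ) +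
      (lam : ℂ) * radialExt (sectorSol m lam) (spherePt t φ)) (𝓝[<] s) (𝓝 _) :=
    (ContinuousAt.tendsto (ContinuousAt.comp (f := fun t => spherePt t φ) hC
      (hasDerivAt_spherePt_latitude s φ).continuousAt)).mono_left nhdsWithin_le_nhds
  refine tendsto_nhds_unique hC2 (tendsto_const_nhds.congr' ?_)
  filter_upwards [Ioo_mem_nhdsLT hs0] with t ht
  exact (sectorSol_eqn_of_lt m lam ⟨ht.1, ht.2.trans_le hs.2⟩ φ).symm

theorem sectorSol_mem_eigenspace {σ lam : ℝ} {m : ℕ}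
    (h : -frob' m lam 1 = σ * frob m lam 1) : sectorSol m lam ∈ eigenspace σ lam m := by
  refine ⟨⟨isC2_sectorSol m lam, sectorSol_eqn m lam, fun p hp => ?_⟩, inSector_sectorSol m lam⟩
  have hpi := Real.pi_pos
  obtain ⟨s, hs, φ, hpt⟩ := exists_eq_spherePt p
  have hs0 : s = 0 := by
    rw [hpt] at hp
    have : Real.sin s = 0 := by simpa [spherePt] using hp
    exact (Real.sin_eq_zero_iff_of_lt_of_lt (by linarith [hs.1]) (by linarith [hs.2])).1 this
  subst hs0
  set e := Complex.exp (Complex.I * m * φ) with he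
  refine ⟨e * (frob' m lam 1 : ℝ), ?_, ?_⟩
  · unfold HasOutwardNormalDeriv
    have hd := (hasDerivAt_profile m lam (s := 0) (by simp)).ofReal_comp.const_mul e
    rw [profileFlux_zero, Real.cos_zero, div_one] at hd
    rw [show -(e * (frob' m lam 1 : ℝ)) = e * ((-frob' m lam 1 : ℝ) : ℂ) by push_cast; ring]
    have hval : ∀ t ∈ Set.Ico 0 Real.pi, radialExt (sectorSol m lam)
        (Real.cos t • p.1 + Real.sin t • north) = e * profile m lam t := fun t ht => by
      rw [hpt, cos_smul_add_sin_smul_north 0 t φ Real.sin_zero Real.cos_zero,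
        radialExt_sectorSol_spherePt m lam (Real.sin_nonneg_of_nonneg_of_le_pi ht.1 ht.2.le)]
    refine hd.hasDerivWithinAt.congr_of_eventuallyEq ?_ (hval 0 ⟨le_rfl, hpi⟩)
    filter_upwards [Ico_mem_nhdsGE hpi] with t ht using hval t ht
  · rw [sectorSol_of_eq m lam hpt, profile_zero, ← he]
    have h' : -(frob' m lam 1 : ℂ) = σ * frob m lam 1 := by exact_mod_cast h
    linear_combination -e * h'

theorem nontrivial_eigenspace_iff (σ lam : ℝ) (m : ℕ) :
    Nontrivial (eigenspace σ lam m) ↔ -frob' m lam 1 = σ * frob m lam 1 := by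
  constructor
  · intro hn
    obtain ⟨F, hF⟩ := exists_ne (0 : eigenspace σ lam m)
    refine (isMeridianProfile_of_mem F.2).robin_condition fun h0 => hF ?_
    exact Subtype.ext (eq_zero_of_mem_eigenspace F.2 h0)
  · intro h
    refine ⟨⟨⟨sectorSol m lam, sectorSol_mem_eigenspace h⟩, 0, fun h0 => ?_⟩⟩
    have h1 : sectorSol m lam = 0 := congrArg Subtype.val h0
    have h2 : frob m lam 1 = 0 := by
      have := radialExt_sectorSol_spherePt m lam (s := 0) (by simp) 0
      rw [h1, radialExt_zero, profile_zero] at this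
      simpa using this.symm
    rw [h2, mul_zero, neg_eq_zero] at h
    exact (frob_one_ne_zero_or m lam).elim (· h2) (· h)

theorem lt_rank_eigenspace_iff (σ lam : ℝ) (m k : ℕ) :
    (k : Cardinal) < Module.rank ℂ (eigenspace σ lam m) ↔
      k = 0 ∧ -frob' m lam 1 = σ * frob m lam 1 := by
  rw [← nontrivial_eigenspace_iff, ← rank_pos_iff_nontrivial (R := ℂ)]
  constructor
  · intro h
    have hk : k = 0 := by
      have := h.trans_le (rank_eigenspace_le_one σ lam m)
      exact Nat.lt_one_iff.1 (by exact_mod_cast this)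
    subst hk
    exact ⟨rfl, by simpa using h⟩
  · rintro ⟨rfl, h⟩
    simpa using h

theorem counting_eq_encard {σ : ℝ} {E : ℕ → ℝ} {M : ℕ → ℕ}
    (hinj : Function.Injective fun n => (E n, M n))
    (hE : ∀ lam m, -frob' m lam 1 = σ * frob m lam 1 ↔ ∃ n, E n = lam ∧ M n = m) (t : ℝ) :
    counting σ t = Set.encard {n | E n ≤ t} := by
  have hinj' : Function.Injective fun n => (E n, M n, 0) := fun a b hab => hinj (by
    simp only [Prod.mk.injEq, and_true] at hab ⊢
    exact hab)
  rw [counting, ← hinj'.encard_image]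
  congr 1
  ext ⟨s, m, k⟩
  simp only [Set.mem_ofPred_eq, lt_rank_eigenspace_iff, hE, Set.mem_image, Prod.mk.injEq]
  constructor
  · rintro ⟨h1, rfl, n, rfl, rfl⟩
    exact ⟨n, h1, rfl, rfl, rfl⟩
  · rintro ⟨n, h1, rfl, rfl, rfl⟩
    exact ⟨h1, rfl, n, rfl, rfl⟩

theorem eigenvalue_eq {σ : ℝ} {E : ℕ → ℝ} {M : ℕ → ℕ} (hmono : Monotone E)
    (hinj : Function.Injective fun n => (E n, M n))
    (hE : ∀ lam m, -frob' m lam 1 = σ * frob m lam 1 ↔ ∃ n, E n = lam ∧ M n = m) (n : ℕ) :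
    eigenvalue σ n = E n := by
  have h : {t : ℝ | (n : ℕ∞) < counting σ t} = Set.Ici (E n) := by
    ext t
    rw [Set.mem_ofPred_eq, counting_eq_encard hinj hE, Set.mem_Ici]
    constructor
    · intro h
      by_contra! hlt
      have hsub : {k | E k ≤ t} ⊆ (Finset.range n : Set ℕ) := fun k hk => by
        rw [Finset.coe_range, Set.mem_Iio]
        by_contra! hnk
        exact (hlt.trans_le (hmono hnk)).not_ge hk
      have := Set.encard_le_encard hsub
      rw [Set.encard_coe_eq_coe_finsetCard, Finset.card_range] at this
      exact h.not_ge this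
    · intro h
      have hsub : (Finset.range (n + 1) : Set ℕ) ⊆ {k | E k ≤ t} := fun k hk => by
        rw [Finset.coe_range, Set.mem_Iio] at hk
        exact (hmono (Nat.lt_succ_iff.1 hk)).trans h
      have := Set.encard_le_encard hsub
      rw [Set.encard_coe_eq_coe_finsetCard, Finset.card_range] at this
      exact lt_of_lt_of_le (by exact_mod_cast Nat.lt_succ_self n) this
  rw [eigenvalue, h, csInf_Ici]

/-- The successor of `(l, j)` in the lexicographic order of the pairs with `j ≤ l / 2`. -/
def nextPos (p : ℕ × ℕ) : ℕ × ℕ := if p.2 < p.1 / 2 then (p.1, p.2 + 1) else (p.1 + 1, 0)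

/-- The enumeration of the pairs `(l, j)` with `j ≤ l / 2` in lexicographic order. -/
def pos : ℕ → ℕ × ℕ
  | 0 => (0, 0)
  | n + 1 => nextPos (pos n)

/-- The number of pairs `(k, j)` with `j ≤ k / 2` and `k < l`. -/
def offset (l : ℕ) : ℕ := ∑ k ∈ Finset.range l, (k / 2 + 1)

theorem offset_succ (l : ℕ) : offset (l + 1) = offset l + l / 2 + 1 := by
  rw [offset, Finset.sum_range_succ, ← offset]; ring

theorem pos_offset_add (l : ℕ) : ∀ j ≤ l / 2, pos (offset l + j) = (l, j) := by
  have step : ∀ l, pos (offset l) = (l, 0) → ∀ j ≤ l / 2, pos (offset l + j) = (l, j) := by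
    intro l h j
    induction j with
    | zero => exact fun _ => h
    | succ j ih =>
      intro hj
      rw [← add_assoc, pos, ih (by omega), nextPos, if_pos (by simp only; omega)]
  refine step l ?_
  induction l with
  | zero => rfl
  | succ l ih => rw [offset_succ, pos, step l ih _ le_rfl, nextPos, if_neg (by simp)]

theorem pos_spec (n : ℕ) : (pos n).2 ≤ (pos n).1 / 2 ∧ offset (pos n).1 + (pos n).2 = n := by
  induction n with
  | zero => simp [pos, offset]
  | succ n ih =>
    rw [pos, nextPos]
    split_ifs with h
    · exact ⟨by simp only; omega, by simp only; omega⟩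
    · refine ⟨by simp, ?_⟩
      simp only [offset_succ]
      omega

/-- The angular momentum of the pair `(l, j)`. -/
def mode (l j : ℕ) : ℕ := 2 * j + l % 2

theorem mode_le {l j : ℕ} (h : j ≤ l / 2) : mode l j ≤ l := by unfold mode; omega

theorem mode_modEq (l j : ℕ) : mode l j ≡ l [MOD 2] := by unfold mode Nat.ModEq; omega

theorem exists_mode_eq {l m : ℕ} (h : m ≤ l) (h2 : m ≡ l [MOD 2]) : ∃ j ≤ l / 2, mode l j = m := by
  unfold Nat.ModEq at h2
  exact ⟨m / 2, by omega, by unfold mode; omega⟩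

theorem eigenvalue_zero_eq (n : ℕ) :
    eigenvalue 0 n = ((pos n).1 : ℝ) * ((pos n).1 + 1) := by
  refine eigenvalue_eq (E := fun n => ((pos n).1 : ℝ) * ((pos n).1 + 1))
    (M := fun n => mode (pos n).1 (pos n).2) ?_ ?_ ?_ n
  · refine monotone_nat_of_le_succ fun n => ?_
    have h : (pos n).1 ≤ (pos (n + 1)).1 := by
      rw [pos, nextPos]
      split_ifs <;> simp
    have h' : ((pos n).1 : ℝ) ≤ (pos (n + 1)).1 := by exact_mod_cast h
    gcongr
  · intro a b hab
    simp only [Prod.mk.injEq] at hab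
    obtain ⟨h1, h2⟩ := hab
    have h3 : (pos a).1 = (pos b).1 := by
      have : (pos a).1 * ((pos a).1 + 1) = (pos b).1 * ((pos b).1 + 1) := by exact_mod_cast h1
      nlinarith
    have h4 : (pos a).2 = (pos b).2 := by
      rw [h3] at h2
      unfold mode at h2
      omega
    rw [← (pos_spec a).2, ← (pos_spec b).2, h3, h4]
  · intro lam m
    rw [zero_mul, neg_eq_zero, neumann_condition_iff]
    constructor
    · rintro ⟨l, h1, h2, rfl⟩
      obtain ⟨j, hj, rfl⟩ := exists_mode_eq h1 h2
      exact ⟨offset l + j, by simp [pos_offset_add l j hj]⟩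
    · rintro ⟨n, rfl, rfl⟩
      exact ⟨(pos n).1, mode_le (pos_spec n).1, mode_modEq _ _, rfl⟩

/-- `ν l j` is the solution of `S_m(ν) = σ` in `(l, l + 1)` for `m = mode l j`. -/
def IsRootFamily (σ : ℝ) (ν : ℕ → ℕ → ℝ) : Prop :=
  ∀ l j : ℕ, j ≤ l / 2 → ν l j ∈ Set.Ioo (l : ℝ) (l + 1) ∧ secular (mode l j) (ν l j) = σ

theorem exists_isRootFamily {σ : ℝ} (hσ : 0 < σ) : ∃ ν, IsRootFamily σ ν := by
  have : ∀ l j : ℕ, ∃ ν : ℝ, j ≤ l / 2 → ν ∈ Set.Ioo (l : ℝ) (l + 1) ∧ secular (mode l j) ν = σ := by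
    intro l j
    by_cases h : j ≤ l / 2
    · obtain ⟨ν, h1, h2⟩ := exists_secular_eq hσ (mode_le h) (mode_modEq l j)
      exact ⟨ν, fun _ => ⟨h1, h2⟩⟩
    · exact ⟨0, fun h' => absurd h' h⟩
  choose ν hν using this
  exact ⟨ν, hν⟩

section RootFamily

variable {σ : ℝ} {ν : ℕ → ℕ → ℝ}

theorem IsRootFamily.lt_succ (h : IsRootFamily σ ν) {l j : ℕ} (hj : j + 1 ≤ l / 2) :
    ν l j < ν l (j + 1) := by
  obtain ⟨h1, h2⟩ := h l j (by omega)
  obtain ⟨h3, h4⟩ := h l (j + 1) hj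
  have hmode : mode l (j + 1) = mode l j + 2 := by unfold mode; ring
  have hle : mode l j + 2 ≤ l := hmode ▸ mode_le hj
  have hmod : mode l j + 2 ≡ l [MOD 2] := hmode ▸ mode_modEq l (j + 1)
  rw [hmode] at h4
  by_contra! hcon
  have a1 : secular (mode l j + 2) (ν l (j + 1)) ≤ secular (mode l j + 2) (ν l j) := by
    rcases hcon.eq_or_lt with he | hlt
    · rw [he]
    · exact (secular_strictMono hle hmod h3 h1 hlt).le
  have a2 : secular (mode l j + 2) (ν l j) < secular (mode l j) (ν l j) := by
    rw [secular_eq_of_modEq hmod, secular_eq_of_modEq (mode_modEq l j)]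
    have hle' : (mode l j : ℝ) + 2 ≤ l := by exact_mod_cast hle
    have := secularFactor_add_two_lt (m := mode l j) (hle'.trans h1.1.le)
    have := tan_half_pi_pos h1
    gcongr
  linarith

/-- The `n`-th Robin eigenvalue in terms of a root family. -/
noncomputable def rootValue (ν : ℕ → ℕ → ℝ) (n : ℕ) : ℝ :=
  ν (pos n).1 (pos n).2 * (ν (pos n).1 (pos n).2 + 1)

theorem rootValue_offset_add (ν : ℕ → ℕ → ℝ) {l j : ℕ} (hj : j ≤ l / 2) :
    rootValue ν (offset l + j) = ν l j * (ν l j + 1) := by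
  rw [rootValue, pos_offset_add l j hj]

theorem IsRootFamily.strictMono (h : IsRootFamily σ ν) : StrictMono (rootValue ν) := by
  refine strictMono_nat_of_lt_succ fun n => ?_
  have hs := (pos_spec n).1
  have h0 := (h _ _ hs).1
  have hnn : (0 : ℝ) ≤ (pos n).1 := Nat.cast_nonneg _
  have hlt : ν (pos n).1 (pos n).2 < ν (pos (n + 1)).1 (pos (n + 1)).2 := by
    rw [pos, nextPos]
    split_ifs with hc
    · exact h.lt_succ hc
    · have := (h ((pos n).1 + 1) 0 (Nat.zero_le _)).1.1
      push_cast at this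
      exact h0.2.trans this
  have := h0.1
  unfold rootValue
  nlinarith

theorem IsRootFamily.mem_cluster_iff (h : IsRootFamily σ ν) (l : ℕ) (x : ℝ) :
    x ∈ cluster σ l ↔ ∃ j ≤ l / 2, rootValue ν (offset l + j) = x := by
  constructor
  · rintro ⟨m, μ, h1, h2, h3, h4, rfl⟩
    obtain ⟨j, hj, rfl⟩ := exists_mode_eq h1 h2
    obtain ⟨h5, h6⟩ := h l j hj
    refine ⟨j, hj, ?_⟩
    rw [rootValue_offset_add ν hj]
    have : ν l j = μ := by
      rcases lt_trichotomy (ν l j) μ with hlt | heq | hgt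
      · have := secular_strictMono h1 h2 h5 h3 hlt
        linarith
      · exact heq
      · have := secular_strictMono h1 h2 h3 h5 hgt
        linarith
    rw [this]
  · rintro ⟨j, hj, rfl⟩
    obtain ⟨h5, h6⟩ := h l j hj
    exact ⟨mode l j, ν l j, mode_le hj, mode_modEq l j, h5, h6, rootValue_offset_add ν hj⟩

theorem IsRootFamily.eigenvalue_eq (h : IsRootFamily σ ν) (hσ : 0 < σ) (n : ℕ) :
    eigenvalue σ n = rootValue ν n := by
  refine RobinHemisphere.eigenvalue_eq (M := fun n => mode (pos n).1 (pos n).2) h.strictMono.monotone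
    (fun a b hab => h.strictMono.injective (Prod.mk.inj hab).1) (fun lam m => ?_) n
  rw [robin_condition_iff hσ]
  constructor
  · rintro ⟨l, μ, h1, h2, h3, h4, rfl⟩
    obtain ⟨j, hj, rfl⟩ := exists_mode_eq h1 h2
    obtain ⟨h5, h6⟩ := h l j hj
    refine ⟨offset l + j, ?_, by simp [pos_offset_add l j hj]⟩
    rw [rootValue_offset_add ν hj]
    have : ν l j = μ := by
      rcases lt_trichotomy (ν l j) μ with hlt | heq | hgt
      · have := secular_strictMono h1 h2 h5 h3 hlt
        linarith
      · exact heq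
      · have := secular_strictMono h1 h2 h3 h5 hgt
        linarith
    rw [this]
  · rintro ⟨n, rfl, rfl⟩
    obtain ⟨h1, -⟩ := pos_spec n
    obtain ⟨h5, h6⟩ := h _ _ h1
    exact ⟨(pos n).1, _, mode_le h1, mode_modEq _ _, h5, h6, rfl⟩

theorem IsRootFamily.clusterMean_eq (h : IsRootFamily σ ν) (hσ : 0 < σ) (l : ℕ) :
    clusterMean σ l = 1 / ((l / 2 + 1 : ℕ) : ℝ) *
      ∑ j ∈ Finset.range (l / 2 + 1), (ν l j * (ν l j + 1) - l * (l + 1)) := by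
  have hinj : Function.Injective fun j => rootValue ν (offset l + j) := fun a b hab => by
    simpa using h.strictMono.injective hab
  have hcl : cluster σ l = (fun j => rootValue ν (offset l + j)) ''
      (Finset.range (l / 2 + 1) : Set ℕ) := by
    ext x
    rw [h.mem_cluster_iff]
    simp
  have hset : {n | eigenvalue σ n ∈ cluster σ l} =
      ((Finset.range (l / 2 + 1)).map (addLeftEmbedding (offset l)) : Finset ℕ) := by
    ext n
    simp only [Set.mem_ofPred_eq, h.eigenvalue_eq hσ, h.mem_cluster_iff, Finset.coe_map,
      Set.mem_image, Finset.coe_range, Set.mem_Iio, Nat.lt_succ_iff, addLeftEmbedding_apply]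
    exact exists_congr fun j => and_congr_right fun _ => h.strictMono.injective.eq_iff
  have hsum : ∑ᶠ (n : ℕ) (_ : eigenvalue σ n ∈ cluster σ l), gap σ n =
      ∑ᶠ n ∈ {n | eigenvalue σ n ∈ cluster σ l}, gap σ n := rfl
  rw [clusterMean, hsum, hset, finsum_mem_coe_finset, Finset.sum_map, hcl,
    Set.ncard_image_of_injective _ hinj, Set.ncard_coe_finset, Finset.card_range]
  congr 1
  refine Finset.sum_congr rfl fun j hj => ?_
  have hj' : j ≤ l / 2 := Nat.lt_succ_iff.1 (Finset.mem_range.1 hj)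
  rw [gap, h.eigenvalue_eq hσ, eigenvalue_zero_eq, addLeftEmbedding_apply,
    rootValue_offset_add ν hj', pos_offset_add l j hj']

end RootFamily

theorem clusterMean_isBigO {σ : ℝ} (hσ : 0 < σ) :
    (fun l : ℕ => clusterMean σ l - 2 * σ) =O[atTop] (fun l : ℕ => (l : ℝ) ^ (-(1 / 2) : ℝ)) := by
  obtain ⟨ν, h⟩ := exists_isRootFamily hσ
  obtain ⟨C, hC⟩ := mean_bound hσ
  refine Asymptotics.IsBigO.of_bound C ?_
  filter_upwards [eventually_ge_atTop 1] with l hl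
  have hb := hC l hl (fun k => ν l (l / 2 - k)) fun k hk => by
    have h1 := h l (l / 2 - k) (by omega)
    rwa [show mode l (l / 2 - k) = l - 2 * k by unfold mode; omega] at h1
  rw [Finset.sum_flip (f := fun k => ν l k * (ν l k + 1) - l * (l + 1)), ← h.clusterMean_eq hσ]
    at hb
  rw [Real.norm_eq_abs, Real.norm_of_nonneg (by positivity), Real.rpow_neg (by positivity),
    ← Real.sqrt_eq_rpow, ← div_eq_mul_inv]
  exact hb

section AreaLength

open MeasureTheory

theorem norm_parallelVec (φ : ℝ) : ‖parallelVec φ‖ = 1 := by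
  simpa using (orthonormal_frame 0 φ).1 1

theorem boundaryLength_eq : boundaryLength = 2 * Real.pi := by
  have h : ∀ φ : ℝ, deriv (fun s : ℝ => (!₂[Real.cos s, Real.sin s, 0] : E3)) φ = parallelVec φ :=
    fun φ => (hasDerivAt_vec3 (Real.hasDerivAt_cos φ) (Real.hasDerivAt_sin φ)
      (hasDerivAt_const φ (0 : ℝ))).deriv
  simp [boundaryLength, h, norm_parallelVec]

theorem area_eq : area = 2 * Real.pi := by
  set μ : Measure E3 := volume
  set A : Set (Metric.sphere (0 : E3) 1) := {p | 0 ≤ (p : E3) 2} with hA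
  set B : Set (Metric.sphere (0 : E3) 1) := {p | (p : E3) 2 ≤ 0} with hB
  have hcont : Continuous fun p : Metric.sphere (0 : E3) 1 => (p : E3) 2 := by fun_prop
  have hAm : MeasurableSet A := (isClosed_le continuous_const hcont).measurableSet
  have hBm : MeasurableSet B := (isClosed_le hcont continuous_const).measurableSet
  have hAB : μ.toSphere A = μ.toSphere B := by
    rw [μ.toSphere_apply' hAm, μ.toSphere_apply' hBm, ← Measure.measure_neg μ]
    congr 2
    ext x
    rw [Set.mem_neg]
    constructor
    · rintro ⟨t, ht, _, ⟨p, hp, rfl⟩, hx⟩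
      have hp' : 0 ≤ (p : E3) 2 := hp
      refine ⟨t, ht, _, ⟨-p, ?_, rfl⟩, ?_⟩
      · simpa [hB] using hp'
      · simpa [neg_eq_iff_eq_neg] using hx
    · rintro ⟨t, ht, _, ⟨p, hp, rfl⟩, hx⟩
      have hp' : (p : E3) 2 ≤ 0 := hp
      refine ⟨t, ht, _, ⟨-p, ?_, rfl⟩, ?_⟩
      · simpa [hA] using hp'
      · simpa using congrArg Neg.neg hx
  have hinter : μ.toSphere (A ∩ B) = 0 := by
    rw [μ.toSphere_apply' (hAm.inter hBm)]
    let V : Submodule ℝ E3 := LinearMap.ker (EuclideanSpace.proj (2 : Fin 3) : E3 →L[ℝ] ℝ).toLinearMap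
    have hV : V ≠ ⊤ := by
      intro h
      have : north ∈ V := h ▸ Submodule.mem_top
      simp [V, north] at this
    have h0 := Measure.addHaar_submodule μ V hV
    refine mul_eq_zero_of_right _ (measure_mono_null ?_ h0)
    rintro _ ⟨t, -, _, ⟨p, hp, rfl⟩, rfl⟩
    have : (p : E3) 2 = 0 := le_antisymm hp.2 hp.1
    simp [V, this]
  have hunion : A ∪ B = Set.univ := by
    ext p
    simpa [hA, hB] using le_total 0 ((p : E3) 2)
  have hreal := measureReal_union_add_inter (μ := μ.toSphere) (s := A) (t := B) hBm
  rw [hunion, Measure.toSphere_real_apply_univ, measureReal_def _ (A ∩ B), hinter,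
    measureReal_def _ B, ← hAB, ← measureReal_def] at hreal
  have hball : μ.real (Metric.ball 0 1) = 4 / 3 * Real.pi := by
    rw [measureReal_def, EuclideanSpace.volume_ball_fin_three, ENNReal.ofReal_one, one_pow, one_mul,
      ENNReal.toReal_ofReal (by positivity)]
    ring
  rw [hball] at hreal
  change μ.toSphere.real A = _
  simp at hreal
  linarith

end AreaLength

end RobinHemisphere

theorem mainTheorem5 (σ : ℝ) (hσ : 0 < σ) :
    ((fun l : ℕ => RobinHemisphere.clusterMean σ l - 2 * σ)
        =O[Filter.atTop] (fun l : ℕ => (l : ℝ) ^ (-(1 / 2) : ℝ))) ∧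
      2 * σ = 2 * σ * (RobinHemisphere.boundaryLength / RobinHemisphere.area) := by
  refine ⟨RobinHemisphere.clusterMean_isBigO hσ, ?_⟩
  rw [RobinHemisphere.boundaryLength_eq, RobinHemisphere.area_eq,
    div_self (mul_pos two_pos Real.pi_pos).ne', mul_one]
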